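/- Let $\mathcal G$ be the star graph with three edges, each identified with $[0,\infty)$, let $L^2(\mathcal G)=\bigoplus_{k=1}^3L^2(0,\infty)$ (complex valued), and let $\gamma\in\mathbb R$. Define $$\mathcal D(\Delta_{\mathcal G}^\gamma)=\Big\{f=(f_1,f_2,f_3)\in\bigoplus_{k=1}^3H^2(0,\infty):\ f_1(0)=f_2(0)=f_3(0),\ \sum_{k=1}^3f_k'(0+)=3\gamma f_1(0)\Big\},\qquad \Delta_{\mathcal G}^\gamma f=(f_1'',f_2'',f_3''),$$ $$\mathcal D(\Delta_{\mathbb R}^\gamma)=\Big\{f\in H^1(\mathbb R)\cap H^2(\mathbb R\setminus\{0\}):\ f'(0+)-f'(0-)=2\gamma f(0)\Big\},\qquad \Delta_{\mathbb R}^\gamma f=f''\ \text{ on }\mathbb R\setminus\{0\}.$$ For $A=\Delta^\gamma_{\mathcal G}$ or $A=\Delta^\gamma_{\mathbb R}$ there is a unique strongly continuous one-parameter unitary group with generator $iA$; it is denoted by $(e^{itA})_{t\in\mathbb R}$. For $\varphi\in L^2(\mathcal G)$ put $$\alpha_1(\varphi)=\tfrac{-2\varphi_1+\varphi_2+\varphi_3}{3},\qquad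 \alpha_2(\varphi)=\tfrac{-\varphi_1-\varphi_2+2\varphi_3}{3},\qquad \alpha_3(\varphi)=\tfrac{\varphi_1+\varphi_2+\varphi_3}{3},$$ and define the bounded operators $\mathcal Q_k:L^2(\mathcal G)\to L^2(\mathbb R)$ ($k=1,2,3$) by letting $\mathcal Q_1\varphi,\mathcal Q_2\varphi$ be the odd extensions to $\mathbb R$ of $\alpha_1(\varphi),\alpha_2(\varphi)$ and $\mathcal Q_3\varphi$ the even extension of $\alpha_3(\varphi)$. Let $\mathcal K=L^2_{\mathrm{odd}}(\mathbb R)\times L^2_{\mathrm{odd}}(\mathbb R)\times L^2_{\mathrm{even}}(\mathbb R)$ and let $\mathcal Q:L^2(\mathcal G)\to\mathcal K$, $\mathcal Q\varphi=(\mathcal Q_1\varphi,\mathcal Q_2\varphi,\mathcal Q_3\varphi)$, which is invertible with $\mathcal Q^{-1}(f_1,f_2,f_3)=(-f_1+f_3,\ f_1-f_2+f_3,\ f_2+f_3)|_{(0,\infty)}$. Then for each $k=1,2,3$, all $t\in\mathbb R$ and all $\varphi\in L^2(\mathcal G)$, $$\mathcal Q_k\,e^{it\Delta_{\mathcal G}^\gamma}\varphi=e^{it\Delta_{\mathbb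 R}^\gamma}\,\mathcal Q_k\varphi .$$ Consequently, with $e^{it\Delta_{\mathbb R}^\gamma}$ acting componentwise (and mapping $\mathcal K$ into $\mathcal K$), $$e^{it\Delta_{\mathcal G}^\gamma}\varphi=\mathcal Q^{-1}e^{it\Delta_{\mathbb R}^\gamma}\mathcal Q\varphi .$$ -/

import Mathlib

open MeasureTheory Set Filter Topology
open scoped ContDiff ENNReal

noncomputable section

namespace StarGraph

/-! ### Lebesgue spaces -/

/-- `L²(0,∞)`, complex valued. -/
abbrev L2Half : Type := Lp ℂ 2 (volume.restrict (Ioi (0 : ℝ)))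

/-- `L²(ℝ)`, complex valued. -/
abbrev L2Line : Type := Lp ℂ 2 (volume : Measure ℝ)

/-- `L²(𝒢)` for the star graph `𝒢` with three edges: the Hilbert direct sum of three copies of
`L²(0,∞)`. -/
abbrev L2Graph : Type := PiLp 2 (fun _ : Fin 3 => L2Half)

/-! ### Weak derivatives and boundary values -/

/-- `g` is the weak (distributional) derivative of `f` on the open set `Ω ⊆ ℝ`. -/
def IsWeakDeriv (Ω : Set ℝ) (f g : ℝ → ℂ) : Prop :=
  ∀ η : ℝ → ℝ, ContDiff ℝ ∞ η → HasCompactSupport η → tsupport η ⊆ Ω →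
    ∫ x in Ω, deriv η x • f x = - ∫ x in Ω, η x • g x

/-- The class `f` has on `Ω` a continuous representative, whose limit at the origin within `Ω` is
`a`. With `Ω = Ioi 0` this is `f(0+) = a`, with `Ω = Iio 0` it is `f(0-) = a`, and with
`Ω = univ` it says that `f` is continuous on `ℝ` and `f(0) = a`. -/
def HasValueAtZero (Ω : Set ℝ) (f : ℝ → ℂ) (a : ℂ) : Prop :=
  ∃ F : ℝ → ℂ, ContinuousOn F Ω ∧ f =ᵐ[volume.restrict Ω] F ∧ Tendsto F (𝓝[Ω] 0) (𝓝 a)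

lemma integrable_smul_of_L2 {Ω : Set ℝ} {f : ℝ → ℂ} (hf : MemLp f 2 (volume.restrict Ω))
    {η : ℝ → ℝ} (hη : Continuous η) (hc : HasCompactSupport η) :
    Integrable (fun x => η x • f x) (volume.restrict Ω) := by
  have h2 : MemLp η 2 (volume.restrict Ω) := hη.memLp_of_hasCompactSupport hc
  exact memLp_one_iff_integrable.mp (hf.smul h2)

lemma integrable_deriv_smul_of_L2 {Ω : Set ℝ} {f : ℝ → ℂ} (hf : MemLp f 2 (volume.restrict Ω))
    {η : ℝ → ℝ} (hη : ContDiff ℝ ∞ η) (hc : HasCompactSupport η) :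
    Integrable (fun x => deriv η x • f x) (volume.restrict Ω) :=
  integrable_smul_of_L2 hf (hη.continuous_deriv (by simp)) hc.deriv

lemma IsWeakDeriv.congr {Ω : Set ℝ} {f f' g g' : ℝ → ℂ} (h : IsWeakDeriv Ω f g)
    (hf : f' =ᵐ[volume.restrict Ω] f) (hg : g' =ᵐ[volume.restrict Ω] g) :
    IsWeakDeriv Ω f' g' := by
  intro η h1 h2 h3
  have e1 : ∫ x in Ω, deriv η x • f' x = ∫ x in Ω, deriv η x • f x :=
    integral_congr_ae (by filter_upwards [hf] with x hx; rw [hx])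
  have e2 : ∫ x in Ω, η x • g' x = ∫ x in Ω, η x • g x :=
    integral_congr_ae (by filter_upwards [hg] with x hx; rw [hx])
  rw [e1, e2, h η h1 h2 h3]

lemma IsWeakDeriv.zero (Ω : Set ℝ) : IsWeakDeriv Ω 0 0 := by
  intro η _ _ _
  simp

lemma IsWeakDeriv.add {Ω : Set ℝ} {f f' g g' : ℝ → ℂ}
    (hf : MemLp f 2 (volume.restrict Ω)) (hf' : MemLp f' 2 (volume.restrict Ω))
    (hg : MemLp g 2 (volume.restrict Ω)) (hg' : MemLp g' 2 (volume.restrict Ω))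
    (h : IsWeakDeriv Ω f g) (h' : IsWeakDeriv Ω f' g') :
    IsWeakDeriv Ω (f + f') (g + g') := by
  intro η h1 h2 h3
  simp only [Pi.add_apply, smul_add]
  rw [integral_add (integrable_deriv_smul_of_L2 hf h1 h2) (integrable_deriv_smul_of_L2 hf' h1 h2),
    integral_add (integrable_smul_of_L2 hg h1.continuous h2)
      (integrable_smul_of_L2 hg' h1.continuous h2), h η h1 h2 h3, h' η h1 h2 h3]
  ring

lemma IsWeakDeriv.smul {Ω : Set ℝ} {f g : ℝ → ℂ} (c : ℂ) (h : IsWeakDeriv Ω f g) :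
    IsWeakDeriv Ω (c • f) (c • g) := by
  intro η h1 h2 h3
  simp only [Pi.smul_apply, smul_comm _ c, integral_smul]
  rw [h η h1 h2 h3, smul_neg]

/-- The weak derivative of zero is zero. -/
lemma IsWeakDeriv.eq_zero {Ω : Set ℝ} (hΩ : IsOpen Ω) {f g : ℝ → ℂ}
    (hg : MemLp g 2 (volume.restrict Ω)) (h : IsWeakDeriv Ω f g)
    (hf : f =ᵐ[volume.restrict Ω] 0) : g =ᵐ[volume.restrict Ω] 0 := by
  have hloc : LocallyIntegrableOn g Ω volume :=
    locallyIntegrableOn_of_locallyIntegrable_restrict (hg.locallyIntegrable (by norm_num))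
  have key := hΩ.ae_eq_zero_of_integral_contDiff_smul_eq_zero hloc (fun η h1 h2 h3 => by
    have e := h η h1 h2 h3
    have e1 : ∫ x in Ω, deriv η x • f x = 0 := by
      rw [integral_congr_ae (g := fun _ => (0 : ℂ))
        (by filter_upwards [hf] with x hx; rw [hx]; simp)]
      simp
    rw [e1] at e
    rw [← setIntegral_eq_integral_of_forall_compl_eq_zero (s := Ω) (fun x hx => by
      rw [image_eq_zero_of_notMem_tsupport (fun hx' => hx (h3 hx')), zero_smul])]
    exact neg_eq_zero.mp e.symm)
  exact (ae_restrict_iff' hΩ.measurableSet).mpr key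

lemma HasValueAtZero.congr {Ω : Set ℝ} {f f' : ℝ → ℂ} {a : ℂ} (h : HasValueAtZero Ω f a)
    (hf : f' =ᵐ[volume.restrict Ω] f) : HasValueAtZero Ω f' a := by
  obtain ⟨F, h1, h2, h3⟩ := h
  exact ⟨F, h1, hf.trans h2, h3⟩

lemma HasValueAtZero.zero (Ω : Set ℝ) : HasValueAtZero Ω 0 0 :=
  ⟨0, continuousOn_const, ae_eq_refl _, tendsto_const_nhds⟩

lemma HasValueAtZero.add {Ω : Set ℝ} {f f' : ℝ → ℂ} {a a' : ℂ} (h : HasValueAtZero Ω f a)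
    (h' : HasValueAtZero Ω f' a') : HasValueAtZero Ω (f + f') (a + a') := by
  obtain ⟨F, h1, h2, h3⟩ := h
  obtain ⟨F', h1', h2', h3'⟩ := h'
  exact ⟨F + F', h1.add h1', h2.add h2', h3.add h3'⟩

lemma HasValueAtZero.smul {Ω : Set ℝ} {f : ℝ → ℂ} {a : ℂ} (c : ℂ) (h : HasValueAtZero Ω f a) :
    HasValueAtZero Ω (c • f) (c • a) := by
  obtain ⟨F, h1, h2, h3⟩ := h
  exact ⟨c • F, h1.const_smul c, h2.const_smul c, h3.const_smul c⟩

/-! ### The Laplacians -/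

/-- `f ∈ 𝒟(Δ_𝒢^γ)` and `Δ_𝒢^γ f = h`: on every edge `f k` has the first and second weak
derivatives `g k`, `h k` in `L²(0,∞)`, so `f ∈ H²(𝒢)`; the values `f k (0)` agree, and
`∑ k, (f k)'(0+) = 3 γ f(0)`. -/
def IsGraphLaplacian (γ : ℝ) (f h : L2Graph) : Prop :=
  ∃ g : L2Graph, (∀ k, IsWeakDeriv (Ioi 0) (f k) (g k)) ∧ (∀ k, IsWeakDeriv (Ioi 0) (g k) (h k)) ∧
    ∃ (a : ℂ) (b : Fin 3 → ℂ), (∀ k, HasValueAtZero (Ioi 0) (f k) a) ∧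
      (∀ k, HasValueAtZero (Ioi 0) (g k) (b k)) ∧ ∑ k, b k = 3 * γ * a

/-- `f ∈ 𝒟(Δ_ℝ^γ)` and `Δ_ℝ^γ f = h`: `f ∈ H¹(ℝ)` with derivative `g`, `f ∈ H²(ℝ ∖ {0})` with
second derivative `h`, and `f'(0+) - f'(0-) = 2 γ f(0)`. -/
def IsLineLaplacian (γ : ℝ) (f h : L2Line) : Prop :=
  ∃ g : L2Line, IsWeakDeriv univ f g ∧ IsWeakDeriv {0}ᶜ g h ∧
    ∃ a b c : ℂ, HasValueAtZero univ f a ∧ HasValueAtZero (Ioi 0) g b ∧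
      HasValueAtZero (Iio 0) g c ∧ b - c = 2 * γ * a

/-- The graph of `Δ_𝒢^γ`. -/
def graphLaplacianGraph (γ : ℝ) : Submodule ℂ (L2Graph × L2Graph) where
  carrier := {p | IsGraphLaplacian γ p.1 p.2}
  zero_mem' := by
    have hz : ⇑(0 : L2Half) =ᵐ[volume.restrict (Ioi (0 : ℝ))] 0 := Lp.coeFn_zero _ _ _
    exact ⟨0, fun _ => (IsWeakDeriv.zero _).congr hz hz, fun _ => (IsWeakDeriv.zero _).congr hz hz,
      0, 0, fun _ => (HasValueAtZero.zero _).congr hz, fun _ => (HasValueAtZero.zero _).congr hz,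
      by simp⟩
  add_mem' := by
    rintro ⟨f, h⟩ ⟨f', h'⟩ ⟨g, h1, h2, a, b, h3, h4, h5⟩ ⟨g', h1', h2', a', b', h3', h4', h5'⟩
    have hadd : ∀ (u v : L2Graph) (k : Fin 3),
        ⇑((u + v) k) =ᵐ[volume.restrict (Ioi (0 : ℝ))] ⇑(u k) + ⇑(v k) :=
      fun u v k => Lp.coeFn_add _ _
    refine ⟨g + g', fun k => ?_, fun k => ?_, a + a', b + b', fun k => ?_, fun k => ?_, ?_⟩
    · exact (IsWeakDeriv.add (Lp.memLp _) (Lp.memLp _) (Lp.memLp _) (Lp.memLp _)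
        (h1 k) (h1' k)).congr (hadd _ _ k) (hadd _ _ k)
    · exact (IsWeakDeriv.add (Lp.memLp _) (Lp.memLp _) (Lp.memLp _) (Lp.memLp _)
        (h2 k) (h2' k)).congr (hadd _ _ k) (hadd _ _ k)
    · exact ((h3 k).add (h3' k)).congr (hadd _ _ k)
    · exact ((h4 k).add (h4' k)).congr (hadd _ _ k)
    · simp only [Pi.add_apply, Finset.sum_add_distrib, h5, h5']
      ring
  smul_mem' := by
    rintro s ⟨f, h⟩ ⟨g, h1, h2, a, b, h3, h4, h5⟩
    have hs : ∀ (u : L2Graph) (k : Fin 3),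
        ⇑((s • u) k) =ᵐ[volume.restrict (Ioi (0 : ℝ))] s • ⇑(u k) :=
      fun u k => Lp.coeFn_smul _ _
    refine ⟨s • g, fun k => ?_, fun k => ?_, s • a, s • b, fun k => ?_, fun k => ?_, ?_⟩
    · exact ((h1 k).smul s).congr (hs _ k) (hs _ k)
    · exact ((h2 k).smul s).congr (hs _ k) (hs _ k)
    · exact ((h3 k).smul s).congr (hs _ k)
    · exact ((h4 k).smul s).congr (hs _ k)
    · simp only [Pi.smul_apply, smul_eq_mul, ← Finset.mul_sum, h5]
      ring

/-- The graph of `Δ_ℝ^γ`. -/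
def lineLaplacianGraph (γ : ℝ) : Submodule ℂ (L2Line × L2Line) where
  carrier := {p | IsLineLaplacian γ p.1 p.2}
  zero_mem' := by
    have hz : ∀ Ω : Set ℝ, ⇑(0 : L2Line) =ᵐ[volume.restrict Ω] 0 :=
      fun _ => ae_restrict_of_ae (Lp.coeFn_zero _ _ _)
    exact ⟨0, (IsWeakDeriv.zero _).congr (hz _) (hz _), (IsWeakDeriv.zero _).congr (hz _) (hz _),
      0, 0, 0, (HasValueAtZero.zero _).congr (hz _), (HasValueAtZero.zero _).congr (hz _),
      (HasValueAtZero.zero _).congr (hz _), by simp⟩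
  add_mem' := by
    rintro ⟨f, h⟩ ⟨f', h'⟩ ⟨g, h1, h2, a, b, c, h3, h4, h5, h6⟩
      ⟨g', h1', h2', a', b', c', h3', h4', h5', h6'⟩
    have hadd : ∀ (u v : L2Line) (Ω : Set ℝ), ⇑(u + v) =ᵐ[volume.restrict Ω] ⇑u + ⇑v :=
      fun u v _ => ae_restrict_of_ae (Lp.coeFn_add _ _)
    have hm : ∀ (u : L2Line) (Ω : Set ℝ), MemLp u 2 (volume.restrict Ω) :=
      fun u _ => (Lp.memLp u).restrict _
    refine ⟨g + g', ?_, ?_, a + a', b + b', c + c', ?_, ?_, ?_, ?_⟩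
    · exact (IsWeakDeriv.add (hm _ _) (hm _ _) (hm _ _) (hm _ _) h1 h1').congr
        (hadd _ _ _) (hadd _ _ _)
    · exact (IsWeakDeriv.add (hm _ _) (hm _ _) (hm _ _) (hm _ _) h2 h2').congr
        (hadd _ _ _) (hadd _ _ _)
    · exact (h3.add h3').congr (hadd _ _ _)
    · exact (h4.add h4').congr (hadd _ _ _)
    · exact (h5.add h5').congr (hadd _ _ _)
    · linear_combination h6 + h6'
  smul_mem' := by
    rintro s ⟨f, h⟩ ⟨g, h1, h2, a, b, c, h3, h4, h5, h6⟩
    have hs : ∀ (u : L2Line) (Ω : Set ℝ), ⇑(s • u) =ᵐ[volume.restrict Ω] s • ⇑u :=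
      fun u _ => ae_restrict_of_ae (Lp.coeFn_smul _ _)
    refine ⟨s • g, ?_, ?_, s • a, s • b, s • c, ?_, ?_, ?_, ?_⟩
    · exact (h1.smul s).congr (hs _ _) (hs _ _)
    · exact (h2.smul s).congr (hs _ _) (hs _ _)
    · exact (h3.smul s).congr (hs _ _)
    · exact (h4.smul s).congr (hs _ _)
    · exact (h5.smul s).congr (hs _ _)
    · simp only [smul_eq_mul]
      linear_combination s * h6

/-- The Laplacian `Δ_𝒢^γ` with a delta condition at the vertex of the star graph with three edges,
as an unbounded operator on `L²(𝒢)`. -/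
def graphLaplacian (γ : ℝ) : L2Graph →ₗ.[ℂ] L2Graph := (graphLaplacianGraph γ).toLinearPMap

/-- The Laplacian `Δ_ℝ^γ` with a delta condition at the origin, as an unbounded operator on
`L²(ℝ)`. -/
def lineLaplacian (γ : ℝ) : L2Line →ₗ.[ℂ] L2Line := (lineLaplacianGraph γ).toLinearPMap

lemma mem_graph_graphLaplacian (γ : ℝ) (f h : L2Graph) :
    (f, h) ∈ (graphLaplacian γ).graph ↔ IsGraphLaplacian γ f h := by
  rw [graphLaplacian, Submodule.toLinearPMap_graph_eq]
  · rfl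
  rintro ⟨f, h⟩ ⟨g, h1, h2, -⟩ h0
  obtain rfl : f = 0 := h0
  ext1 k
  have hz : ⇑((0 : L2Graph) k) =ᵐ[volume.restrict (Ioi (0 : ℝ))] 0 := Lp.coeFn_zero _ _ _
  have hg := (h1 k).eq_zero isOpen_Ioi (Lp.memLp _) hz
  exact (Lp.eq_zero_iff_ae_eq_zero).mpr ((h2 k).eq_zero isOpen_Ioi (Lp.memLp _) hg)

lemma mem_graph_lineLaplacian (γ : ℝ) (f h : L2Line) :
    (f, h) ∈ (lineLaplacian γ).graph ↔ IsLineLaplacian γ f h := by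
  rw [lineLaplacian, Submodule.toLinearPMap_graph_eq]
  · rfl
  rintro ⟨f, h⟩ ⟨g, h1, h2, -⟩ h0
  obtain rfl : f = 0 := h0
  have hz : ⇑(0 : L2Line) =ᵐ[volume.restrict (univ : Set ℝ)] 0 :=
    ae_restrict_of_ae (Lp.coeFn_zero _ _ _)
  have hg := h1.eq_zero isOpen_univ ((Lp.memLp _).restrict _) hz
  rw [Measure.restrict_univ] at hg
  have hh := h2.eq_zero isOpen_compl_singleton ((Lp.memLp _).restrict _) (ae_restrict_of_ae hg)
  have e : (volume : Measure ℝ).restrict {0}ᶜ = volume :=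
    Measure.restrict_eq_self_of_ae_mem (by simp [ae_iff])
  rw [e] at hh
  exact (Lp.eq_zero_iff_ae_eq_zero).mpr hh

/-! ### The Schrödinger propagator -/

/-- `U` is the strongly continuous one-parameter unitary group with generator `i A`, that is
`U t = e^{itA}`: the derivative of `t ↦ U t f` at `t = 0` exists exactly when `f ∈ 𝒟(A)`, and it is
then `i A f`. -/
structure IsUnitaryGroupOf {H : Type*} [NormedAddCommGroup H] [InnerProductSpace ℂ H]
    [CompleteSpace H] (A : H →ₗ.[ℂ] H) (U : ℝ → H →L[ℂ] H) : Prop where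
  mem_unitary : ∀ t, U t ∈ unitary (H →L[ℂ] H)
  map_zero : U 0 = 1
  map_add : ∀ s t, U (s + t) = U s * U t
  continuous : ∀ f, Continuous fun t => U t f
  generator : ∀ f h, (f, h) ∈ A.graph ↔ HasDerivAt (fun t => U t f) (Complex.I • h) 0

open scoped Classical in
/-- The propagator `t ↦ e^{itA}` of an unbounded operator `A`: the unitary group generated by `i A`
(with the value `0` if there is none). -/
def propagator {H : Type*} [NormedAddCommGroup H] [InnerProductSpace ℂ H] [CompleteSpace H]
    (A : H →ₗ.[ℂ] H) : ℝ → H →L[ℂ] H :=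
  if h : ∃ U, IsUnitaryGroupOf A U then h.choose else 0

/-! ### The odd/even decomposition -/

/-- The extension of a function on `[0,∞)` to `ℝ` by `σ f(-x)` for `x < 0`: the odd extension for
`σ = -1` and the even extension for `σ = 1`. -/
def reflExtend (σ : ℂ) (f : ℝ → ℂ) : ℝ → ℂ := fun x => if x < 0 then σ * f (-x) else f x

lemma measurePreserving_neg_Iio : MeasurePreserving (fun x : ℝ => -x)
    (volume.restrict (Iio 0)) (volume.restrict (Ioi 0)) := by
  have h := (Measure.measurePreserving_neg (volume : Measure ℝ)).restrict_preimage
    (measurableSet_Ioi (a := (0 : ℝ)))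
  have e : (Neg.neg : ℝ → ℝ) ⁻¹' Ioi 0 = Iio 0 := by ext x; simp
  rw [e] at h
  exact h

lemma ae_of_half {p : ℝ → Prop} (h1 : ∀ᵐ x ∂volume.restrict (Ioi (0 : ℝ)), p x)
    (h2 : ∀ᵐ x ∂volume.restrict (Iio (0 : ℝ)), p x) : ∀ᵐ x : ℝ, p x := by
  rw [ae_restrict_iff' measurableSet_Ioi] at h1
  rw [ae_restrict_iff' measurableSet_Iio] at h2
  have h3 : ∀ᵐ x : ℝ, x ≠ 0 := by simp [ae_iff]
  filter_upwards [h1, h2, h3] with x a b c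
  rcases lt_or_gt_of_ne c with h | h
  · exact b h
  · exact a h

lemma reflExtend_ae_pos (σ : ℂ) (f : ℝ → ℂ) :
    reflExtend σ f =ᵐ[volume.restrict (Ioi (0 : ℝ))] f := by
  filter_upwards [ae_restrict_mem measurableSet_Ioi] with x hx
  simp [reflExtend, not_lt.mpr (le_of_lt (mem_Ioi.mp hx))]

lemma reflExtend_ae_neg (σ : ℂ) (f : ℝ → ℂ) :
    reflExtend σ f =ᵐ[volume.restrict (Iio (0 : ℝ))] fun x => σ * f (-x) := by
  filter_upwards [ae_restrict_mem measurableSet_Iio] with x hx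
  simp [reflExtend, mem_Iio.mp hx]

lemma reflExtend_congr (σ : ℂ) {f g : ℝ → ℂ} (h : f =ᵐ[volume.restrict (Ioi (0 : ℝ))] g) :
    reflExtend σ f =ᵐ[volume] reflExtend σ g := by
  refine ae_of_half ?_ ?_
  · exact (reflExtend_ae_pos σ f).trans (h.trans (reflExtend_ae_pos σ g).symm)
  · refine (reflExtend_ae_neg σ f).trans (EventuallyEq.trans ?_ (reflExtend_ae_neg σ g).symm)
    filter_upwards [measurePreserving_neg_Iio.quasiMeasurePreserving.ae h] with x hx
    rw [hx]

lemma reflExtend_ae_eq (σ : ℂ) (f : ℝ → ℂ) : reflExtend σ f =ᵐ[volume]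
    (Iio (0 : ℝ)).indicator (fun x => σ * f (-x)) + (Ioi (0 : ℝ)).indicator f := by
  refine ae_of_half ?_ ?_
  · filter_upwards [reflExtend_ae_pos σ f, ae_restrict_mem measurableSet_Ioi] with x h1 h2
    have h3 : ¬ x < 0 := not_lt.mpr (le_of_lt h2)
    simp [h1, mem_Ioi.mp h2, h3]
  · filter_upwards [reflExtend_ae_neg σ f, ae_restrict_mem measurableSet_Iio] with x h1 h2
    have h3 : ¬ 0 < x := not_lt.mpr (le_of_lt h2)
    simp [h1, mem_Iio.mp h2, h3]

lemma memLp_reflect (σ : ℂ) {f : ℝ → ℂ} (hf : MemLp f 2 (volume.restrict (Ioi (0 : ℝ)))) :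
    MemLp (fun x => σ * f (-x)) 2 (volume.restrict (Iio (0 : ℝ))) :=
  (hf.comp_measurePreserving measurePreserving_neg_Iio).const_mul σ

lemma memLp_reflExtend (σ : ℂ) {f : ℝ → ℂ} (hf : MemLp f 2 (volume.restrict (Ioi (0 : ℝ)))) :
    MemLp (reflExtend σ f) 2 volume :=
  (memLp_congr_ae (reflExtend_ae_eq σ f)).mpr
    (((memLp_indicator_iff_restrict measurableSet_Iio).mpr (memLp_reflect σ hf)).add
      ((memLp_indicator_iff_restrict measurableSet_Ioi).mpr hf))

lemma eLpNorm_reflExtend_le (σ : ℂ) {f : ℝ → ℂ} (hf : MemLp f 2 (volume.restrict (Ioi (0 : ℝ)))) :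
    eLpNorm (reflExtend σ f) 2 volume ≤
      (‖σ‖ₑ + 1) * eLpNorm f 2 (volume.restrict (Ioi (0 : ℝ))) := by
  rw [eLpNorm_congr_ae (reflExtend_ae_eq σ f)]
  refine (eLpNorm_add_le
    ((memLp_indicator_iff_restrict measurableSet_Iio).mpr (memLp_reflect σ hf)).1
    ((memLp_indicator_iff_restrict measurableSet_Ioi).mpr hf).1 (by norm_num)).trans ?_
  rw [eLpNorm_indicator_eq_eLpNorm_restrict measurableSet_Iio,
    eLpNorm_indicator_eq_eLpNorm_restrict measurableSet_Ioi, add_mul, one_mul]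
  gcongr
  have e : (fun x : ℝ => σ * f (-x)) = σ • (f ∘ fun x : ℝ => -x) := rfl
  rw [e, eLpNorm_const_smul, eLpNorm_comp_measurePreserving hf.1 measurePreserving_neg_Iio]

/-- The map `f ↦ reflExtend σ f` as a bounded operator `L²(0,∞) → L²(ℝ)`. -/
def reflExtendL (σ : ℂ) : L2Half →L[ℂ] L2Line :=
  LinearMap.mkContinuous
    { toFun := fun f => (memLp_reflExtend σ (Lp.memLp f)).toLp (reflExtend σ f)
      map_add' := by
        intro f g
        rw [← MemLp.toLp_add]
        refine MemLp.toLp_congr _ _ ((reflExtend_congr σ (Lp.coeFn_add f g)).trans ?_)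
        refine Eventually.of_forall fun x => ?_
        simp only [reflExtend, Pi.add_apply]
        split_ifs
        · ring
        · rfl
      map_smul' := by
        intro c f
        rw [RingHom.id_apply, ← MemLp.toLp_const_smul]
        refine MemLp.toLp_congr _ _ ((reflExtend_congr σ (Lp.coeFn_smul c f)).trans ?_)
        refine Eventually.of_forall fun x => ?_
        simp only [reflExtend, Pi.smul_apply, smul_eq_mul]
        split_ifs
        · ring
        · rfl }
    (‖σ‖ + 1) (by
      intro f
      have h := ENNReal.toReal_mono (ENNReal.mul_ne_top (by simp) (Lp.memLp f).2.ne)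
        (eLpNorm_reflExtend_le σ (Lp.memLp f))
      rw [ENNReal.toReal_mul, ENNReal.toReal_add (by simp) (by simp)] at h
      change ‖(memLp_reflExtend σ (Lp.memLp f)).toLp (reflExtend σ f)‖ ≤ _
      rw [Lp.norm_toLp]
      simpa [Lp.norm_def] using h)

lemma coeFn_reflExtendL (σ : ℂ) (f : L2Half) : reflExtendL σ f =ᵐ[volume] reflExtend σ f :=
  MemLp.coeFn_toLp (memLp_reflExtend σ (Lp.memLp f))

/-- The combinations `α₁ = (-2φ₁ + φ₂ + φ₃)/3`, `α₂ = (-φ₁ - φ₂ + 2φ₃)/3`,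
`α₃ = (φ₁ + φ₂ + φ₃)/3` (indexed from `0`). -/
def alpha : Fin 3 → L2Graph → L2Half :=
  ![fun φ => (3 : ℂ)⁻¹ • (-(2 : ℂ) • φ 0 + φ 1 + φ 2),
    fun φ => (3 : ℂ)⁻¹ • (-φ 0 - φ 1 + (2 : ℂ) • φ 2),
    fun φ => (3 : ℂ)⁻¹ • (φ 0 + φ 1 + φ 2)]

/-- The parity of `𝒬 k φ`: odd for the first two components, even for the third. -/
def paritySign : Fin 3 → ℂ := ![-1, -1, 1]

lemma alpha_add (k : Fin 3) (φ ψ : L2Graph) : alpha k (φ + ψ) = alpha k φ + alpha k ψ := by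
  fin_cases k <;> simp [alpha] <;> module

lemma alpha_smul (k : Fin 3) (c : ℂ) (φ : L2Graph) : alpha k (c • φ) = c • alpha k φ := by
  fin_cases k <;> simp [alpha] <;> module

lemma continuous_alpha (k : Fin 3) : Continuous (alpha k) := by
  fin_cases k <;> simp only [alpha] <;> simp <;> fun_prop

/-- The bounded operators `𝒬₁, 𝒬₂, 𝒬₃ : L²(𝒢) → L²(ℝ)` (indexed from `0`): `𝒬₁ φ`, `𝒬₂ φ` are the
odd extensions of `α₁(φ)`, `α₂(φ)`, and `𝒬₃ φ` is the even extension of `α₃(φ)`. -/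
def oddEven (k : Fin 3) : L2Graph →L[ℂ] L2Line where
  toFun φ := reflExtendL (paritySign k) (alpha k φ)
  map_add' φ ψ := by rw [alpha_add, _root_.map_add]
  map_smul' c φ := by rw [alpha_smul, map_smul]; rfl
  cont := (reflExtendL _).continuous.comp (continuous_alpha k)

lemma ae_comp_neg {p : ℝ → Prop} (h : ∀ᵐ x : ℝ, p x) : ∀ᵐ x : ℝ, p (-x) :=
  (Measure.measurePreserving_neg (volume : Measure ℝ)).quasiMeasurePreserving.ae h

/-- The space `𝒦 = L²_odd(ℝ) × L²_odd(ℝ) × L²_even(ℝ)`. -/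
def parityTriples : Submodule ℂ (Fin 3 → L2Line) where
  carrier := {f | ∀ k, ∀ᵐ x : ℝ, f k (-x) = paritySign k * f k x}
  zero_mem' := by
    intro k
    simp
  add_mem' := by
    intro f g hf hg k
    have h : ∀ᵐ x : ℝ, (f k + g k) x = f k x + g k x := Lp.coeFn_add _ _
    filter_upwards [h, ae_comp_neg h, hf k, hg k] with x h1 h2 h3 h4
    simp only [Pi.add_apply]
    rw [h1, h2, h3, h4, mul_add]
  smul_mem' := by
    intro c f hf k
    have h : ∀ᵐ x : ℝ, (c • f k) x = c * f k x := Lp.coeFn_smul _ _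
    filter_upwards [h, ae_comp_neg h, hf k] with x h1 h2 h3
    simp only [Pi.smul_apply]
    rw [h1, h2, h3]
    ring

/-- Restriction `L²(ℝ) → L²(0,∞)`. -/
def restrictHalf : L2Line →L[ℂ] L2Half := LpToLpRestrictCLM ℝ ℂ ℂ volume 2 (Ioi 0)

lemma coeFn_restrictHalf (f : L2Line) : restrictHalf f =ᵐ[volume.restrict (Ioi (0 : ℝ))] f :=
  LpToLpRestrictCLM_coeFn ℂ (Ioi 0) f

lemma oddEven_mem (φ : L2Graph) : (fun k => oddEven k φ) ∈ parityTriples := by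
  intro k
  have h : ∀ᵐ x : ℝ, oddEven k φ x = reflExtend (paritySign k) (alpha k φ) x :=
    coeFn_reflExtendL _ _
  have h0 : ∀ᵐ x : ℝ, x ≠ 0 := by simp [ae_iff]
  have hs : paritySign k * paritySign k = 1 := by fin_cases k <;> simp [paritySign]
  filter_upwards [h, ae_comp_neg h, h0] with x h1 h2 h3
  rw [h1, h2]
  rcases lt_or_gt_of_ne h3 with h4 | h4
  · have h5 : ¬ (-x < 0) := by linarith
    simp only [reflExtend, h4, h5, if_true, if_false]
    rw [← mul_assoc, hs, one_mul]
  · have h5 : ¬ (x < 0) := by linarith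
    have h6 : -x < 0 := by linarith
    simp only [reflExtend, h5, h6, if_true, if_false, neg_neg]

lemma restrictHalf_reflExtendL (σ : ℂ) (f : L2Half) : restrictHalf (reflExtendL σ f) = f :=
  Lp.ext ((coeFn_restrictHalf _).trans (EventuallyEq.trans
    (ae_restrict_of_ae (coeFn_reflExtendL σ f)) (reflExtend_ae_pos σ f)))

lemma reflExtendL_restrictHalf {σ : ℂ} (hσ : σ * σ = 1) {f : L2Line}
    (hf : ∀ᵐ x : ℝ, f (-x) = σ * f x) : reflExtendL σ (restrictHalf f) = f := by
  refine Lp.ext ((coeFn_reflExtendL _ _).trans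
    ((reflExtend_congr σ (coeFn_restrictHalf f)).trans ?_))
  filter_upwards [hf] with x hx
  simp only [reflExtend]
  split_ifs
  · rw [hx, ← mul_assoc, hσ, one_mul]
  · rfl

/-- The invertible operator `𝒬 : L²(𝒢) → 𝒦`, `𝒬 φ = (𝒬₁ φ, 𝒬₂ φ, 𝒬₃ φ)`, together with its inverse
`(f₁, f₂, f₃) ↦ (-f₁ + f₃, f₁ - f₂ + f₃, f₂ + f₃)` restricted to `(0,∞)`. -/
def oddEvenEquiv : L2Graph ≃ₗ[ℂ] parityTriples where
  toFun φ := ⟨fun k => oddEven k φ, oddEven_mem φ⟩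
  map_add' φ ψ := by ext1; funext k; exact _root_.map_add (oddEven k) φ ψ
  map_smul' c φ := by ext1; funext k; exact map_smul (oddEven k) c φ
  invFun f := WithLp.toLp 2 ![restrictHalf (-f.1 0 + f.1 2),
    restrictHalf (f.1 0 - f.1 1 + f.1 2), restrictHalf (f.1 1 + f.1 2)]
  left_inv φ := by
    ext1 k
    fin_cases k <;>
      simp [oddEven, restrictHalf_reflExtendL, alpha] <;> module
  right_inv f := by
    ext1
    funext k
    have hs : paritySign k * paritySign k = 1 := by fin_cases k <;> simp [paritySign]
    refine Eq.trans ?_ (reflExtendL_restrictHalf hs (f.2 k))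
    change reflExtendL _ _ = _
    congr 1
    fin_cases k <;> simp [alpha] <;> module

end StarGraph

end

open StarGraph

noncomputable section

namespace StarGraph

/-! ### Unitary groups generated by operators with a self-adjoint resolvent -/

/-! Both Laplacians are studied through one resolvent `R = (m² - A)⁻¹` at a real point with `m > 0`
and `m + γ > 0`. On each half-line `R` is the Dirichlet resolvent plus a multiple of `exp (-m x)`,
and that multiple is the common boundary value, which the vertex condition determines. An odd
function sees only the Dirichlet part. For an even function, the condition at the origin of the line
and the condition at the vertex of the star give the same boundary value. Hence each `𝒬 k`
intertwines the two resolvents (`oddEven_graphResolvent`), and therefore maps the graph of one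
Laplacian into the graph of the other.

To pass from generators to groups, let `U` and `V` be the groups on the graph and on the line. For
`f` in the domain, the function `s ↦ V (-s) 𝒬 (U s f)` has derivative zero, so it is constant;
density of the domain finishes the argument (`IsUnitaryGroupOf.intertwine`). Uniqueness of the
groups is the same statement for the identity operator.

Existence uses only the continuous functional calculus of the bounded self-adjoint `R`. Since `A =
lam - R⁻¹` with `lam = m²`, the operator `e^{itA} R` is the function `x e^{it(lam - 1/x)}` of `R`,
which is continuous even at `x = 0`. It satisfies `‖e^{itA} R h‖ = ‖R h‖`, so `e^{itA}` extends from
the dense range of `R` to an isometry (`resolventGroup`, `exists_unitaryGroup_of_resolvent`).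

The Dirichlet resolvent is obtained from an orthogonal projection, which makes its self-adjointness
immediate (`dirichletResolvent_spec`). The boundary derivative comes from the factorisation of `∂² -
m²` into first-order operators (`hasValueAtZero_of_isWeakDeriv_growth`), and the same factorisation
shows that `m² - A` is injective (`L2_ode_solution`). -/

lemma norm_exp_I_mul_sub_one_sub_le (s : ℝ) :
    ‖Complex.exp (Complex.I * s) - 1 - Complex.I * s‖ ≤ 2 * s ^ 2 := by
  have hs : ‖Complex.I * (s : ℂ)‖ = |s| := by simp
  rcases le_or_gt |s| 1 with h | h
  · have := Complex.norm_exp_sub_one_sub_id_le (x := Complex.I * s) (by rwa [hs])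
    rw [hs, sq_abs] at this
    nlinarith [sq_nonneg s]
  · have h1 : ‖Complex.exp (Complex.I * s) - 1‖ ≤ |s| := Real.norm_exp_I_mul_ofReal_sub_one_le
    have h2 := norm_sub_le (Complex.exp (Complex.I * s) - 1) (Complex.I * s)
    rw [hs] at h2
    nlinarith [sq_abs s]

/-- The function `x ↦ x e^{it(lam - 1/x)}`: if `R = (lam - A)⁻¹` then it takes `R` to
`e^{itA} R`. -/
def phase (lam t x : ℝ) : ℂ := x * Complex.exp (Complex.I * ((t * (lam - x⁻¹) : ℝ) : ℂ))

lemma norm_phase (lam t x : ℝ) : ‖phase lam t x‖ = |x| := by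
  rw [phase, norm_mul, mul_comm Complex.I, Complex.norm_exp_ofReal_mul_I]
  simp

/-- The exponential oscillates as `x → 0`, but the factor `x` damps it. Continuity at `0` matters
because `0` may lie in the spectrum of the resolvent. -/
lemma continuous_phase (lam t : ℝ) : Continuous (phase lam t) := by
  rw [continuous_iff_continuousAt]
  intro x
  rcases eq_or_ne x 0 with rfl | hx
  · have h0 : phase lam t 0 = 0 := by simp [phase]
    rw [ContinuousAt, h0]
    refine squeeze_zero_norm (fun y => (norm_phase lam t y).le) ?_
    simpa using (continuous_abs : Continuous fun y : ℝ => |y|).tendsto 0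
  · unfold phase
    have h1 : ContinuousAt (fun y : ℝ => y⁻¹) x := continuousAt_inv₀ hx
    fun_prop

lemma phase_mul_phase (lam s t x : ℝ) :
    phase lam s x * phase lam t x = x * phase lam (s + t) x := by
  have e : Complex.I * (((s + t) * (lam - x⁻¹) : ℝ) : ℂ) =
      Complex.I * ((s * (lam - x⁻¹) : ℝ) : ℂ) + Complex.I * ((t * (lam - x⁻¹) : ℝ) : ℂ) := by
    push_cast; ring
  rw [phase, phase, phase, e, Complex.exp_add]
  ring

lemma phase_zero (lam x : ℝ) : phase lam 0 x = x := by simp [phase]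

lemma star_phase (lam t x : ℝ) : star (phase lam t x) = phase lam (-t) x := by
  simp only [phase, star_mul', Complex.star_def, Complex.conj_ofReal, ← Complex.exp_conj, map_mul,
    Complex.conj_I]
  congr 2
  push_cast
  ring

/-- The linear Taylor term in `t` is `i t (lam x - 1)`. Uniformly for bounded `x` the remainder is
only `O(t)`, since the frequency `lam - 1/x` is unbounded; one more factor `x` improves this to
`O(t²)` in `norm_mul_phase_sub_le`. -/
lemma norm_phase_sub_le (lam t x : ℝ) :
    ‖phase lam t x - x - Complex.I * t * (lam * x - 1)‖ ≤ 2 * (|lam| * |x| + 1) * |t| := by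
  have hb : |lam * x - 1| ≤ |lam| * |x| + 1 := by
    simpa [abs_mul] using abs_sub (lam * x) 1
  have h2 : ‖Complex.I * t * (lam * x - 1)‖ ≤ (|lam| * |x| + 1) * |t| := by
    have e : (lam * x - 1 : ℂ) = ((lam * x - 1 : ℝ) : ℂ) := by push_cast; ring
    rw [e, norm_mul, norm_mul, Complex.norm_I, one_mul, Complex.norm_real, Complex.norm_real,
      mul_comm]
    exact mul_le_mul_of_nonneg_right hb (abs_nonneg _)
  have h1 : ‖phase lam t x - x‖ ≤ (|lam| * |x| + 1) * |t| := by
    rcases eq_or_ne x 0 with rfl | hx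
    · simp [phase]
    · have e : phase lam t x - x =
          x * (Complex.exp (Complex.I * ((t * (lam - x⁻¹) : ℝ) : ℂ)) - 1) := by
        rw [phase]; ring
      rw [e, norm_mul, Complex.norm_real, Real.norm_eq_abs]
      refine (mul_le_mul_of_nonneg_left Real.norm_exp_I_mul_ofReal_sub_one_le
        (abs_nonneg x)).trans ?_
      rw [Real.norm_eq_abs, ← abs_mul]
      have e2 : x * (t * (lam - x⁻¹)) = (lam * x - 1) * t := by field_simp
      rw [e2, abs_mul]
      exact mul_le_mul_of_nonneg_right hb (abs_nonneg _)
  linarith [norm_sub_le (phase lam t x - x) (Complex.I * t * (lam * x - 1))]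

lemma norm_mul_phase_sub_le (lam t x : ℝ) :
    ‖x * (phase lam t x - x - Complex.I * t * (lam * x - 1))‖ ≤
      2 * (|lam| * |x| + 1) ^ 2 * t ^ 2 := by
  rcases eq_or_ne x 0 with rfl | hx
  · simp only [Complex.ofReal_zero, zero_mul, norm_zero]
    positivity
  have hb : |lam * x - 1| ≤ |lam| * |x| + 1 := by
    simpa [abs_mul] using abs_sub (lam * x) 1
  have hx' : (x : ℂ) ≠ 0 := by exact_mod_cast hx
  have e : x * (phase lam t x - x - Complex.I * t * (lam * x - 1)) =
      x ^ 2 * (Complex.exp (Complex.I * ((t * (lam - x⁻¹) : ℝ) : ℂ)) - 1 -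
        Complex.I * ((t * (lam - x⁻¹) : ℝ) : ℂ)) := by
    rw [phase]; push_cast; field_simp
  rw [e, norm_mul, norm_pow, Complex.norm_real, Real.norm_eq_abs, sq_abs]
  refine (mul_le_mul_of_nonneg_left (norm_exp_I_mul_sub_one_sub_le _) (sq_nonneg x)).trans ?_
  have e2 : x ^ 2 * (2 * (t * (lam - x⁻¹)) ^ 2) = 2 * (lam * x - 1) ^ 2 * t ^ 2 := by
    field_simp
  rw [e2]
  have : (lam * x - 1) ^ 2 ≤ (|lam| * |x| + 1) ^ 2 := by
    rw [← sq_abs (lam * x - 1)]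
    gcongr
  gcongr

/-! ### Functional calculus of a bounded self-adjoint resolvent. -/

section Hilbert

variable {H : Type*} [NormedAddCommGroup H] [InnerProductSpace ℂ H]

/-- By `h1` the operator `R` is a right inverse of `lam - A`, and by `h2` that operator is
injective; hence `R` is a two-sided inverse and determines the graph of `A`. -/
lemma graph_iff_of_resolvent {A : H →ₗ.[ℂ] H} {R : H →L[ℂ] H} {lam : ℝ}
    (h1 : ∀ φ, (R φ, (lam : ℂ) • R φ - φ) ∈ A.graph)
    (h2 : ∀ d, (d, (lam : ℂ) • d) ∈ A.graph → d = 0) (f h : H) :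
    (f, h) ∈ A.graph ↔ R ((lam : ℂ) • f - h) = f := by
  constructor
  · intro hf
    have h3 := A.graph.sub_mem (h1 ((lam : ℂ) • f - h)) hf
    refine sub_eq_zero.mp (h2 _ ?_)
    have e : (R ((lam : ℂ) • f - h) - f, (lam : ℂ) • (R ((lam : ℂ) • f - h) - f)) =
        (R ((lam : ℂ) • f - h), (lam : ℂ) • R ((lam : ℂ) • f - h) - ((lam : ℂ) • f - h)) -
          (f, h) := by
      rw [Prod.mk_sub_mk]
      congr 1
      module
    rwa [e]
  · intro hf
    have h3 := h1 ((lam : ℂ) • f - h)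
    rwa [hf, sub_sub_cancel] at h3

/-- If `R f = 0` then `(0, -f)` lies in the graph of the single-valued operator `A`. -/
lemma resolvent_injective {A : H →ₗ.[ℂ] H} {R : H →L[ℂ] H} {lam : ℝ}
    (h1 : ∀ φ, (R φ, (lam : ℂ) • R φ - φ) ∈ A.graph) (f : H) (hf : R f = 0) : f = 0 := by
  have h3 := h1 f
  rw [hf, smul_zero, zero_sub] at h3
  exact neg_eq_zero.mp (A.graph_fst_eq_zero_snd h3 rfl)

variable [CompleteSpace H]

/-- The operator `e^{itA} R`, for `R = (lam - A)⁻¹`. -/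
def phaseOp (lam : ℝ) (R : H →L[ℂ] H) (t : ℝ) : H →L[ℂ] H :=
  -- The functional calculus is taken over `ℂ` because `phase` has complex values; the real part
  -- changes nothing on the real spectrum of a self-adjoint `R`.
  cfc (fun z : ℂ => phase lam t z.re) R

lemma continuous_phase_re (lam t : ℝ) : Continuous fun z : ℂ => phase lam t z.re :=
  (continuous_phase lam t).comp Complex.continuous_re

lemma phaseOp_zero {R : H →L[ℂ] H} (hR : IsSelfAdjoint R) (lam : ℝ) : phaseOp lam R 0 = R := by
  rw [phaseOp]
  have h : cfc (fun z : ℂ => phase lam 0 z.re) R = cfc (fun z : ℂ => z) R := by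
    refine cfc_congr fun z hz => ?_
    rw [phase_zero, ← hR.mem_spectrum_eq_re hz]
  rw [h, cfc_id' ℂ R hR.isStarNormal]

lemma phaseOp_mul_phaseOp {R : H →L[ℂ] H} (hR : IsSelfAdjoint R) (lam s t : ℝ) :
    phaseOp lam R s * phaseOp lam R t = R * phaseOp lam R (s + t) := by
  have h := phaseOp_zero hR lam
  nth_rw 3 [← h]
  simp only [phaseOp]
  rw [← cfc_mul _ _ R (continuous_phase_re lam s).continuousOn (continuous_phase_re lam t).continuousOn,
    ← cfc_mul _ _ R (continuous_phase_re lam 0).continuousOn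
      (continuous_phase_re lam (s + t)).continuousOn]
  simp only [phase_mul_phase, phase_zero]

lemma phaseOp_commute {R : H →L[ℂ] H} (hR : IsSelfAdjoint R) (lam t : ℝ) :
    phaseOp lam R t * R = R * phaseOp lam R t := by
  have := phaseOp_mul_phaseOp hR lam t 0
  rwa [phaseOp_zero hR, add_zero] at this

lemma star_phaseOp (lam : ℝ) (R : H →L[ℂ] H) (t : ℝ) :
    star (phaseOp lam R t) = phaseOp lam R (-t) := by
  rw [phaseOp, ← cfc_star]
  simp only [star_phase, phaseOp]

/-- Because `|phase lam t x|² = x²`, the operators `phaseOp lam R t` and `R` have the same `T* T`.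
-/
lemma norm_phaseOp_apply {R : H →L[ℂ] H} (hR : IsSelfAdjoint R) (lam t : ℝ) (h : H) :
    ‖phaseOp lam R t h‖ = ‖R h‖ := by
  have e : star (phaseOp lam R t) * phaseOp lam R t = star R * R := by
    rw [star_phaseOp, phaseOp_mul_phaseOp hR, neg_add_cancel, phaseOp_zero hR, hR.star_eq]
  have h1 := ContinuousLinearMap.apply_norm_sq_eq_inner_adjoint_right (phaseOp lam R t) h
  have h2 := ContinuousLinearMap.apply_norm_sq_eq_inner_adjoint_right R h
  change star (phaseOp lam R t) * phaseOp lam R t = star R * R at e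
  rw [ContinuousLinearMap.star_eq_adjoint, ContinuousLinearMap.star_eq_adjoint] at e
  have e' := congrArg (fun T : H →L[ℂ] H => T h) e
  have h3 : ‖phaseOp lam R t h‖ ^ 2 = ‖R h‖ ^ 2 := by
    rw [h1, h2]
    exact congrArg (fun v => RCLike.re (inner ℂ h v)) e'
  exact (sq_eq_sq₀ (norm_nonneg _) (norm_nonneg _)).mp h3

lemma phaseOp_sub_eq {R : H →L[ℂ] H} (hR : IsSelfAdjoint R) (lam t : ℝ) :
    phaseOp lam R t - R - (Complex.I * t) • ((lam : ℂ) • R - 1) =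
      cfc (fun z : ℂ => phase lam t z.re - z.re - Complex.I * t * (lam * z.re - 1)) R := by
  have hre : cfc (fun z : ℂ => (z.re : ℂ)) R = R := by
    have := phaseOp_zero hR lam
    simpa only [phaseOp, phase_zero] using this
  have hc : Continuous fun z : ℂ => (z.re : ℂ) := by fun_prop
  have hp := continuous_phase_re lam t
  have hn := hR.isStarNormal
  rw [cfc_sub (a := R) (fun z : ℂ => phase lam t z.re - z.re)
    (fun z : ℂ => Complex.I * t * (lam * z.re - 1)) (hp.sub hc).continuousOn (by fun_prop),
    cfc_sub (a := R) (fun z : ℂ => phase lam t z.re) (fun z : ℂ => (z.re : ℂ)) hp.continuousOn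
      (by fun_prop), cfc_const_mul (a := R) (Complex.I * t) (fun z : ℂ => (lam * z.re - 1 : ℂ))
      (by fun_prop), cfc_sub (a := R) (fun z : ℂ => (lam * z.re : ℂ)) (fun _ : ℂ => (1 : ℂ))
      (by fun_prop) (by fun_prop), cfc_const_mul (a := R) (lam : ℂ) (fun z : ℂ => (z.re : ℂ))
      (by fun_prop), hre, cfc_const_one ℂ R, phaseOp]

lemma abs_re_le_norm {R : H →L[ℂ] H} {z : ℂ} (hz : z ∈ spectrum ℂ R) : |z.re| ≤ ‖R‖ := by
  refine (Complex.abs_re_le_norm z).trans ?_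
  have : Nontrivial H := by
    by_contra hs
    rw [not_nontrivial_iff_subsingleton] at hs
    have : Subsingleton (H →L[ℂ] H) := ⟨fun a b => by ext x; exact Subsingleton.elim _ _⟩
    rw [spectrum.of_subsingleton] at hz
    exact hz
  exact spectrum.norm_le_norm_of_mem hz

lemma norm_phaseOp_sub_le {R : H →L[ℂ] H} (hR : IsSelfAdjoint R) (lam t : ℝ) :
    ‖phaseOp lam R t - R - (Complex.I * t) • ((lam : ℂ) • R - 1)‖ ≤
      2 * (|lam| * ‖R‖ + 1) * |t| := by
  rw [phaseOp_sub_eq hR]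
  refine norm_cfc_le (by positivity) fun z hz => (norm_phase_sub_le lam t z.re).trans ?_
  have := abs_re_le_norm hz
  gcongr

lemma norm_phaseOp_sub_mul_le {R : H →L[ℂ] H} (hR : IsSelfAdjoint R) (lam t : ℝ) :
    ‖R * (phaseOp lam R t - R - (Complex.I * t) • ((lam : ℂ) • R - 1))‖ ≤
      2 * (|lam| * ‖R‖ + 1) ^ 2 * t ^ 2 := by
  have hre : cfc (fun z : ℂ => (z.re : ℂ)) R = R := by
    have := phaseOp_zero hR lam
    simpa only [phaseOp, phase_zero] using this
  rw [phaseOp_sub_eq hR]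
  nth_rw 1 [← hre]
  have hp := continuous_phase_re lam t
  have hq : Continuous fun z : ℂ =>
      phase lam t z.re - z.re - Complex.I * t * (lam * z.re - 1) :=
    (hp.sub (by fun_prop)).sub (by fun_prop)
  rw [← cfc_mul (a := R) (fun z : ℂ => (z.re : ℂ)) _ (by fun_prop) hq.continuousOn]
  refine norm_cfc_le (by positivity) fun z hz => (norm_mul_phase_sub_le lam t z.re).trans ?_
  have := abs_re_le_norm hz
  gcongr

lemma phaseOp_sub_commute {R : H →L[ℂ] H} (hR : IsSelfAdjoint R) (lam t : ℝ) :
    (phaseOp lam R t - R - (Complex.I * t) • ((lam : ℂ) • R - 1)) * R =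
      R * (phaseOp lam R t - R - (Complex.I * t) • ((lam : ℂ) • R - 1)) := by
  rw [sub_mul, sub_mul, mul_sub, mul_sub, phaseOp_commute hR, smul_mul_assoc, mul_smul_comm,
    sub_mul, mul_sub, smul_mul_assoc, mul_smul_comm, one_mul, mul_one]

/-- The orthogonal complement of the range is the kernel of `R* = R`. -/
lemma denseRange_of_selfAdjoint {R : H →L[ℂ] H} (hR : IsSelfAdjoint R)
    (hinj : ∀ f, R f = 0 → f = 0) : DenseRange R := by
  have h1 : R.range.topologicalClosure = ⊤ := by
    rw [Submodule.topologicalClosure_eq_top_iff, ContinuousLinearMap.orthogonal_range,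
      ← ContinuousLinearMap.star_eq_adjoint, hR.star_eq, Submodule.eq_bot_iff]
    exact fun x hx => hinj x hx
  have h2 := Submodule.dense_iff_topologicalClosure_eq_top.mpr h1
  rwa [LinearMap.coe_range] at h2

lemma hasDerivAt_phaseOp {R : H →L[ℂ] H} (hR : IsSelfAdjoint R) (hd : DenseRange R) (lam : ℝ)
    (h : H) :
    HasDerivAt (fun t => phaseOp lam R t h) (Complex.I • ((lam : ℂ) • R h - h)) 0 := by
  rw [hasDerivAt_iff_isLittleO, Asymptotics.isLittleO_iff]
  intro ε hε
  set C := |lam| * ‖R‖ + 1 with hC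
  have hC0 : 0 < C := by positivity
  -- Approximate `h` by `R k`: the remainder `D` is `O(t)` on the small vector `h - R k` and `O(t²)`
  -- on `R k`. The tolerances `ε / (4 C)` and `δ` make each contribution at most `ε / 2 * |t|`.
  obtain ⟨k, hk⟩ := hd.exists_dist_lt h (ε := ε / (4 * C)) (by positivity)
  rw [dist_eq_norm] at hk
  have hδ : 0 < ε / (4 * C ^ 2 * (‖k‖ + 1)) := by positivity
  filter_upwards [Metric.ball_mem_nhds (0 : ℝ) hδ] with t ht
  rw [Metric.mem_ball, dist_zero_right, Real.norm_eq_abs] at ht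
  set D := phaseOp lam R t - R - (Complex.I * t) • ((lam : ℂ) • R - 1) with hD
  have e : phaseOp lam R t h - phaseOp lam R 0 h - (t - 0) • (Complex.I • ((lam : ℂ) • R h - h)) =
      D (h - R k) + (R * D) k := by
    rw [← phaseOp_sub_commute hR]
    rw [mul_apply_eq_comp, ← map_add, sub_add_cancel, hD, phaseOp_zero hR, sub_zero]
    simp only [sub_apply, smul_apply,
      one_apply_eq_self]
    rw [mul_comm, mul_smul]
    rfl
  rw [e, sub_zero, Real.norm_eq_abs]
  have h1 : ‖D (h - R k)‖ ≤ ε / 2 * |t| := by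
    refine (D.le_opNorm _).trans ?_
    refine (mul_le_mul (norm_phaseOp_sub_le hR lam t) hk.le (norm_nonneg _) (by positivity)).trans
      (le_of_eq ?_)
    rw [← hC]; field_simp; ring
  have h2 : ‖(R * D) k‖ ≤ ε / 2 * |t| := by
    refine ((R * D).le_opNorm _).trans ?_
    refine (mul_le_mul_of_nonneg_right (norm_phaseOp_sub_mul_le hR lam t) (norm_nonneg _)).trans ?_
    rw [← hC, ← sq_abs t]
    rw [lt_div_iff₀ (by positivity)] at ht
    have : 2 * C ^ 2 * |t| ^ 2 * ‖k‖ ≤ (|t| * (4 * C ^ 2 * (‖k‖ + 1))) / 2 * |t| := by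
      nlinarith [mul_nonneg (sq_nonneg C) (sq_nonneg |t|), norm_nonneg k]
    refine this.trans ?_
    gcongr
  linarith [norm_add_le (D (h - R k)) ((R * D) k)]

/-- The unitary group generated by `i(lam - R⁻¹)`. -/
def resolventGroup (lam : ℝ) (R : H →L[ℂ] H) (t : ℝ) : H →L[ℂ] H :=
  (phaseOp lam R t).toLinearMap.extendOfNorm R.toLinearMap

/-- The extension is well defined: `‖phaseOp lam R t x‖ ≤ ‖R x‖` shows that `R x ↦ phaseOp lam R t
x` is a bounded map on the dense range. -/
lemma resolventGroup_apply {R : H →L[ℂ] H} (hR : IsSelfAdjoint R) (hd : DenseRange R)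
    (lam t : ℝ) (h : H) : resolventGroup lam R t (R h) = phaseOp lam R t h :=
  LinearMap.extendOfNorm_eq (f := (phaseOp lam R t).toLinearMap) (e := R.toLinearMap) hd
    ⟨1, fun x => by rw [one_mul]; exact (norm_phaseOp_apply hR lam t x).le⟩ h

lemma norm_resolventGroup_apply {R : H →L[ℂ] H} (hR : IsSelfAdjoint R) (hd : DenseRange R)
    (lam t : ℝ) (f : H) : ‖resolventGroup lam R t f‖ = ‖f‖ := by
  refine hd.induction_on (p := fun f => ‖resolventGroup lam R t f‖ = ‖f‖) f
    (isClosed_eq (by fun_prop) (by fun_prop)) fun h => ?_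
  rw [resolventGroup_apply hR hd, norm_phaseOp_apply hR]

lemma resolventGroup_zero {R : H →L[ℂ] H} (hR : IsSelfAdjoint R) (hd : DenseRange R)
    (lam : ℝ) : resolventGroup lam R 0 = 1 := by
  ext f
  refine hd.induction_on (p := fun f => resolventGroup lam R 0 f = f) f
    (isClosed_eq (by fun_prop) (by fun_prop)) fun h => ?_
  rw [resolventGroup_apply hR hd, phaseOp_zero hR]

lemma resolventGroup_commute {R : H →L[ℂ] H} (hR : IsSelfAdjoint R) (hd : DenseRange R)
    (lam t : ℝ) (f : H) : resolventGroup lam R t (R f) = R (resolventGroup lam R t f) := by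
  refine hd.induction_on
    (p := fun f => resolventGroup lam R t (R f) = R (resolventGroup lam R t f)) f
    (isClosed_eq (by fun_prop) (by fun_prop)) fun h => ?_
  rw [resolventGroup_apply hR hd, resolventGroup_apply hR hd]
  exact congrArg (fun T : H →L[ℂ] H => T h) (phaseOp_commute hR lam t)

lemma resolventGroup_add {R : H →L[ℂ] H} (hR : IsSelfAdjoint R) (hd : DenseRange R)
    (lam s t : ℝ) :
    resolventGroup lam R (s + t) = resolventGroup lam R s * resolventGroup lam R t := by
  ext f
  refine hd.induction_on (p := fun f => resolventGroup lam R (s + t) f =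
    (resolventGroup lam R s * resolventGroup lam R t) f) f
    (isClosed_eq (by fun_prop) (by fun_prop)) fun f => ?_
  -- The density argument is used twice, to reach vectors `R (R h)`: the multiplication law for
  -- `phaseOp` carries a spare factor `R`.
  refine hd.induction_on (p := fun f => resolventGroup lam R (s + t) (R f) =
    (resolventGroup lam R s * resolventGroup lam R t) (R f)) f
    (isClosed_eq (by fun_prop) (by fun_prop)) fun h => ?_
  rw [mul_apply_eq_comp, resolventGroup_apply hR hd, resolventGroup_commute hR hd,
    resolventGroup_apply hR hd lam t, resolventGroup_apply hR hd]
  have e := congrArg (fun T : H →L[ℂ] H => T h) (phaseOp_mul_phaseOp hR lam s t)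
  have e' := congrArg (fun T : H →L[ℂ] H => T h) (phaseOp_commute hR lam (s + t))
  exact e'.trans e.symm

lemma resolventGroup_mem_unitary {R : H →L[ℂ] H} (hR : IsSelfAdjoint R) (hd : DenseRange R)
    (lam t : ℝ) : resolventGroup lam R t ∈ unitary (H →L[ℂ] H) := by
  have h1 : star (resolventGroup lam R t) * resolventGroup lam R t = 1 :=
    (ContinuousLinearMap.norm_map_iff_adjoint_comp_self _).mp
      (norm_resolventGroup_apply hR hd lam t)
  have h2 : resolventGroup lam R t * resolventGroup lam R (-t) = 1 := by
    rw [← resolventGroup_add hR hd, add_neg_cancel, resolventGroup_zero hR hd]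
  refine Unitary.mem_iff.mpr ⟨h1, ?_⟩
  rw [left_inv_eq_right_inv h1 h2, h2]

lemma hasDerivAt_resolventGroup {R : H →L[ℂ] H} (hR : IsSelfAdjoint R) (hd : DenseRange R)
    (lam : ℝ) (h : H) : HasDerivAt (fun t => resolventGroup lam R t (R h))
      (Complex.I • ((lam : ℂ) • R h - h)) 0 := by
  simp only [resolventGroup_apply hR hd]
  exact hasDerivAt_phaseOp hR hd lam h

lemma continuous_resolventGroup {R : H →L[ℂ] H} (hR : IsSelfAdjoint R) (hd : DenseRange R)
    (lam : ℝ) (f : H) : Continuous fun t => resolventGroup lam R t f := by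
  have key : Tendsto (fun t => resolventGroup lam R t f) (𝓝 0) (𝓝 f) := by
    rw [Metric.tendsto_nhds]
    intro ε hε
    obtain ⟨k, hk⟩ := hd.exists_dist_lt f (ε := ε / 3) (by positivity)
    have hc := (hasDerivAt_resolventGroup hR hd lam k).continuousAt.tendsto
    rw [resolventGroup_zero hR hd, one_apply_eq_self, Metric.tendsto_nhds] at hc
    filter_upwards [hc (ε / 3) (by positivity)] with t ht
    -- Isometry makes this error uniform in `t`, so continuity at `0` passes from the range of `R`
    -- to every vector.
    have h1 : dist (resolventGroup lam R t f) (resolventGroup lam R t (R k)) = dist f (R k) := by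
      rw [dist_eq_norm, ← map_sub, norm_resolventGroup_apply hR hd, dist_eq_norm]
    have h2 := dist_triangle4 (resolventGroup lam R t f) (resolventGroup lam R t (R k)) (R k) f
    rw [dist_comm (R k) f] at h2
    linarith
  rw [continuous_iff_continuousAt]
  intro t
  have e : (fun s => resolventGroup lam R s f) =
      fun s => resolventGroup lam R t (resolventGroup lam R (s - t) f) := by
    funext s
    rw [← mul_apply_eq_comp, ← resolventGroup_add hR hd, add_sub_cancel]
  rw [ContinuousAt, e]
  have h0 : Tendsto (fun s : ℝ => s - t) (𝓝 t) (𝓝 0) := by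
    simpa using (by fun_prop : Continuous fun s : ℝ => s - t).tendsto t
  have := ((resolventGroup lam R t).continuous.tendsto f).comp (key.comp h0)
  simpa [Function.comp_def, resolventGroup_zero hR hd] using this

/-- An operator `A` with bounded self-adjoint inverse `R` of `lam - A` is the generator, up to the
factor `i`, of a unitary group. -/
theorem isUnitaryGroupOf_resolventGroup {A : H →ₗ.[ℂ] H} {R : H →L[ℂ] H} (hR : IsSelfAdjoint R)
    (hinj : ∀ f, R f = 0 → f = 0) {lam : ℝ}
    (hA : ∀ f h, (f, h) ∈ A.graph ↔ R ((lam : ℂ) • f - h) = f) :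
    IsUnitaryGroupOf A (resolventGroup lam R) where
  mem_unitary := resolventGroup_mem_unitary hR (denseRange_of_selfAdjoint hR hinj) lam
  map_zero := resolventGroup_zero hR (denseRange_of_selfAdjoint hR hinj) lam
  map_add := resolventGroup_add hR (denseRange_of_selfAdjoint hR hinj) lam
  continuous := continuous_resolventGroup hR (denseRange_of_selfAdjoint hR hinj) lam
  generator f h := by
    have hd := denseRange_of_selfAdjoint hR hinj
    rw [hA]
    constructor
    · intro hf
      have := hasDerivAt_resolventGroup hR hd lam ((lam : ℂ) • f - h)
      rwa [hf, sub_sub_cancel] at this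
    · intro hf
      -- Nothing is known about `f` itself, but `R f` lies in the range of `R`, where the derivative
      -- has already been computed. Comparing the two derivatives gives `R h = lam R f - f`.
      have h1 : HasDerivAt (fun t => R (resolventGroup lam R t f)) (R (Complex.I • h)) 0 :=
        R.restrictScalars ℝ |>.hasFDerivAt.comp_hasDerivAt 0 hf
      simp only [← resolventGroup_commute hR hd] at h1
      have h2 := h1.unique (hasDerivAt_resolventGroup hR hd lam f)
      rw [map_smul] at h2
      have h3 : R h = (lam : ℂ) • R f - f :=
        smul_right_injective H Complex.I_ne_zero h2
      rw [map_sub, map_smul, h3, sub_sub_cancel]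

/-! ### Intertwining and uniqueness of unitary groups. -/

lemma IsUnitaryGroupOf.norm_apply {A : H →ₗ.[ℂ] H} {U : ℝ → H →L[ℂ] H}
    (hU : IsUnitaryGroupOf A U) (t : ℝ) (f : H) : ‖U t f‖ = ‖f‖ :=
  (ContinuousLinearMap.norm_map_iff_adjoint_comp_self _).mpr
    (Unitary.star_mul_self_of_mem (hU.mem_unitary t)) f

lemma IsUnitaryGroupOf.apply_mem_graph {A : H →ₗ.[ℂ] H} {U : ℝ → H →L[ℂ] H}
    (hU : IsUnitaryGroupOf A U) {f h : H} (hf : (f, h) ∈ A.graph) (t : ℝ) :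
    (U t f, U t h) ∈ A.graph := by
  rw [hU.generator] at hf ⊢
  have h1 : HasDerivAt (fun s => U t (U s f)) (U t (Complex.I • h)) 0 :=
    (U t).restrictScalars ℝ |>.hasFDerivAt.comp_hasDerivAt 0 hf
  rw [map_smul] at h1
  refine h1.congr_of_eventuallyEq (Eventually.of_forall fun s => ?_)
  change U s (U t f) = U t (U s f)
  rw [← mul_apply_eq_comp, ← hU.map_add, add_comm, hU.map_add]
  rfl

variable {K : Type*} [NormedAddCommGroup K] [InnerProductSpace ℂ K] [CompleteSpace K]

/-- A product rule in which the two derivatives `T (i h)` and `-i T h` cancel. As `V` is only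
strongly differentiable on a domain, the increment is split into three pieces, estimated by the
isometry of `V (-s)`, by its strong continuity, and by its derivative at `T f`. -/
lemma IsUnitaryGroupOf.hasDerivAt_conj_zero {A : H →ₗ.[ℂ] H} {B : K →ₗ.[ℂ] K}
    {U : ℝ → H →L[ℂ] H} {V : ℝ → K →L[ℂ] K} (hU : IsUnitaryGroupOf A U)
    (hV : IsUnitaryGroupOf B V) (T : H →L[ℂ] K)
    (hT : ∀ f h, (f, h) ∈ A.graph → (T f, T h) ∈ B.graph) {f h : H} (hf : (f, h) ∈ A.graph) :
    HasDerivAt (fun s => V (-s) (T (U s f))) 0 0 := by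
  have hu : HasDerivAt (fun s => T (U s f)) (T (Complex.I • h)) 0 :=
    T.restrictScalars ℝ |>.hasFDerivAt.comp_hasDerivAt 0 ((hU.generator f h).mp hf)
  have hv : HasDerivAt (fun s => V (-s) (T f)) (-(Complex.I • T h)) 0 := by
    have h0 := (hV.generator _ _).mp (hT f h hf)
    have h1 : HasDerivAt (fun s => V s (T f)) (Complex.I • T h) (-0) := by rwa [neg_zero]
    simpa [Function.comp_def] using h1.scomp (0 : ℝ) (hasDerivAt_neg (0 : ℝ))
  rw [hasDerivAt_iff_isLittleO] at hu hv ⊢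
  have hT0 : Tendsto (fun s => V (-s) (T (Complex.I • h))) (𝓝 0) (𝓝 (T (Complex.I • h))) := by
    have := ((hV.continuous (T (Complex.I • h))).comp continuous_neg).tendsto 0
    simpa [Function.comp_def, hV.map_zero] using this
  have h1 : (fun s => V (-s) (T (U s f) - T (U 0 f) - (s - 0) • T (Complex.I • h))) =o[𝓝 0]
      fun s => s - 0 := by
    refine Asymptotics.IsBigO.trans_isLittleO ?_ hu
    exact Asymptotics.IsBigO.of_bound 1
      (Eventually.of_forall fun s => by rw [hV.norm_apply, one_mul])
  have h2 : (fun s : ℝ => (s - 0) • (V (-s) (T (Complex.I • h)) - T (Complex.I • h))) =o[𝓝 0]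
      fun s => s - 0 := by
    have h3 : (fun s => V (-s) (T (Complex.I • h)) - T (Complex.I • h)) =o[𝓝 0]
        fun _ => (1 : ℝ) := by
      rw [Asymptotics.isLittleO_one_iff]
      simpa using hT0.sub_const (T (Complex.I • h))
    simpa using (Asymptotics.isBigO_refl (fun s : ℝ => s - 0) (𝓝 0)).smul_isLittleO h3
  refine ((h1.add h2).add hv).congr_left fun s => ?_
  simp only [hU.map_zero, hV.map_zero, neg_zero, one_apply_eq_self, map_sub,
    map_smul, sub_zero, smul_zero]
  have e : V (-s) (s • (Complex.I • T h)) = s • (Complex.I • V (-s) (T h)) := by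
    rw [← Complex.coe_smul, map_smul, map_smul, Complex.coe_smul]
  rw [e]
  simp only [smul_sub, smul_neg]
  abel

/-- If `T` maps the graph of `A` into the graph of `B`, it intertwines the unitary groups. -/
theorem IsUnitaryGroupOf.intertwine {A : H →ₗ.[ℂ] H} {B : K →ₗ.[ℂ] K}
    {U : ℝ → H →L[ℂ] H} {V : ℝ → K →L[ℂ] K} (hU : IsUnitaryGroupOf A U)
    (hV : IsUnitaryGroupOf B V) (hA : Dense (A.domain : Set H)) (T : H →L[ℂ] K)
    (hT : ∀ f h, (f, h) ∈ A.graph → (T f, T h) ∈ B.graph) (t : ℝ) (f : H) :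
    T (U t f) = V t (T f) := by
  have hcore : ∀ f h, (f, h) ∈ A.graph → T (U t f) = V t (T f) := by
    intro f h hf
    have hder : ∀ t, HasDerivAt (fun s => V (-s) (T (U s f))) 0 t := by
      intro t
      -- The group law turns the derivative at `t` into the derivative at `0` for the vector `U t
      -- f`, which is still in the domain.
      have h1 := hU.hasDerivAt_conj_zero hV T hT (hU.apply_mem_graph hf t)
      have h2 : HasDerivAt (fun s => V (-t) (V (-s) (T (U s (U t f))))) (V (-t) 0) 0 :=
        (V (-t)).restrictScalars ℝ |>.hasFDerivAt.comp_hasDerivAt 0 h1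
      rw [_root_.map_zero] at h2
      rw [← sub_self t] at h2
      refine (h2.comp_sub_const t t).congr_of_eventuallyEq (Eventually.of_forall fun s => ?_)
      change V (-s) (T (U s f)) = V (-t) (V (-(s - t)) (T (U (s - t) (U t f))))
      rw [← mul_apply_eq_comp, ← mul_apply_eq_comp (U _), ← hV.map_add, ← hU.map_add]
      congr 2 <;> ring_nf
    have hconst := is_const_of_deriv_eq_zero (fun t => (hder t).differentiableAt)
      (fun t => (hder t).deriv) t 0
    simp only [neg_zero, hU.map_zero, hV.map_zero, one_apply_eq_self] at hconst
    rw [← hconst, ← mul_apply_eq_comp, ← hV.map_add, add_neg_cancel, hV.map_zero]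
    rfl
  refine hA.induction (P := fun f => T (U t f) = V t (T f)) (fun f hf => ?_)
    (isClosed_eq (by fun_prop) (by fun_prop)) f
  exact hcore f (A ⟨f, hf⟩) (A.mem_graph ⟨f, hf⟩)

theorem IsUnitaryGroupOf.unique {A : H →ₗ.[ℂ] H} {U V : ℝ → H →L[ℂ] H}
    (hU : IsUnitaryGroupOf A U) (hV : IsUnitaryGroupOf A V) (hA : Dense (A.domain : Set H)) :
    U = V := by
  funext t
  ext f
  exact hU.intertwine hV hA 1 (fun _ _ h => h) t f

lemma isUnitaryGroupOf_propagator {A : H →ₗ.[ℂ] H} (h : ∃ U, IsUnitaryGroupOf A U) :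
    IsUnitaryGroupOf A (propagator A) := by
  rw [propagator, dif_pos h]
  exact h.choose_spec

/-- An operator with a self-adjoint resolvent at the real point `lam` is densely defined and is
the generator, up to the factor `i`, of a unique unitary group. -/
theorem exists_unitaryGroup_of_resolvent {A : H →ₗ.[ℂ] H} {R : H →L[ℂ] H} (hR : IsSelfAdjoint R)
    {lam : ℝ} (h1 : ∀ φ, (R φ, (lam : ℂ) • R φ - φ) ∈ A.graph)
    (h2 : ∀ d, (d, (lam : ℂ) • d) ∈ A.graph → d = 0) :
    Dense (A.domain : Set H) ∧ ∃ U, IsUnitaryGroupOf A U := by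
  have hinj := resolvent_injective h1
  refine ⟨(denseRange_of_selfAdjoint hR hinj).mono ?_, _,
    isUnitaryGroupOf_resolventGroup hR hinj (graph_iff_of_resolvent h1 h2)⟩
  rintro _ ⟨φ, rfl⟩
  exact A.mem_domain_of_mem_graph (h1 φ)

end Hilbert

/-! ### Weak derivatives on the half-line -/

lemma MemLp.integrableOn_Icc {g : ℝ → ℂ} (hg : MemLp g 2 (volume.restrict (Ioi (0 : ℝ)))) (M : ℝ) :
    IntegrableOn g (Icc 0 M) := by
  rw [integrableOn_Icc_iff_integrableOn_Ioc]
  have h : MemLp g 2 (volume.restrict (Ioc (0 : ℝ) M)) :=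
    hg.mono_measure (Measure.restrict_mono Ioc_subset_Ioi_self le_rfl)
  exact h.integrable (by norm_num)

lemma exists_pos_forall_ge_eq_zero {η : ℝ → ℝ} (hc : HasCompactSupport η) :
    ∃ M > 0, ∀ x ≥ M, η x = 0 ∧ deriv η x = 0 := by
  obtain ⟨R, hR⟩ := hc.isCompact.isBounded.subset_closedBall 0
  refine ⟨max R 0 + 1, by positivity, fun x hx => ?_⟩
  have hx' : x ∉ tsupport η := fun h => by
    have := hR h
    rw [Metric.mem_closedBall, dist_zero_right, Real.norm_eq_abs] at this
    linarith [le_abs_self x, le_max_left R 0]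
  exact ⟨image_eq_zero_of_notMem_tsupport hx',
    image_eq_zero_of_notMem_tsupport fun h => hx' (tsupport_deriv_subset h)⟩

/-- Integration by parts of a primitive against a test function. -/
lemma integral_deriv_smul_primitive {g : ℝ → ℂ} (hg : ∀ M, IntegrableOn g (Icc 0 M)) {η : ℝ → ℝ}
    (hη : ContDiff ℝ ∞ η) (hc : HasCompactSupport η) :
    ∫ x in Ioi (0 : ℝ), deriv η x • ∫ y in (0 : ℝ)..x, g y = -∫ x in Ioi (0 : ℝ), η x • g x := by
  obtain ⟨M, hM, hz⟩ := exists_pos_forall_ge_eq_zero hc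
  have hd : Continuous (deriv η) := hη.continuous_deriv (by simp)
  have cut : ∀ F : ℝ → ℂ, (∀ x ≥ M, F x = 0) →
      ∫ x in Ioi (0 : ℝ), F x = ∫ x in Ioc 0 M, F x := fun F hF =>
    (setIntegral_eq_of_subset_of_forall_sdiff_eq_zero measurableSet_Ioi Ioc_subset_Ioi_self
      fun x hx => hF x (by
        by_contra h
        exact hx.2 ⟨hx.1, (not_le.mp h).le⟩))
  rw [cut _ fun x hx => by rw [(hz x hx).2, zero_smul],
    cut _ fun x hx => by rw [(hz x hx).1, zero_smul]]
  have hgM : Integrable g (volume.restrict (Ioc 0 M)) := (hg M).mono_set Ioc_subset_Icc_self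
  have hdM : Integrable (deriv η) (volume.restrict (Ioc 0 M)) :=
    (hd.integrableOn_Icc (a := 0) (b := M)).mono_set Ioc_subset_Icc_self
  -- Fubini on the triangle `y < x`. The inner integral of `deriv η` over `(y, M]` is `-η y`. Since
  -- the primitive vanishes at `0`, no boundary term appears, even though `η 0` is arbitrary.
  have hS : MeasurableSet {p : ℝ × ℝ | p.2 < p.1} := measurableSet_lt measurable_snd measurable_fst
  have hint : Integrable (Function.uncurry fun x y =>
      {p : ℝ × ℝ | p.2 < p.1}.indicator (fun p => deriv η p.1 • g p.2) (x, y))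
      ((volume.restrict (Ioc 0 M)).prod (volume.restrict (Ioc 0 M))) :=
    (hdM.smul_prod hgM).indicator hS
  have hswap := integral_integral_swap hint
  have e1 : ∀ x ∈ Ioc 0 M, (∫ y in Ioc 0 M,
      {p : ℝ × ℝ | p.2 < p.1}.indicator (fun p => deriv η p.1 • g p.2) (x, y)) =
      deriv η x • ∫ y in (0 : ℝ)..x, g y := by
    intro x hx
    have e : (fun y => {p : ℝ × ℝ | p.2 < p.1}.indicator (fun p => deriv η p.1 • g p.2) (x, y)) =
        (Iio x).indicator fun y => deriv η x • g y := by
      funext y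
      simp [indicator]
    rw [e, setIntegral_indicator measurableSet_Iio, integral_smul,
      intervalIntegral.integral_of_le hx.1.le, integral_Ioc_eq_integral_Ioo]
    congr 3
    ext y
    simp only [mem_inter_iff, mem_Ioc, mem_Iio, mem_Ioo]
    exact ⟨fun h => ⟨h.1.1, h.2⟩, fun h => ⟨⟨h.1, h.2.le.trans hx.2⟩, h.2⟩⟩
  have e2 : ∀ y ∈ Ioc 0 M, (∫ x in Ioc 0 M,
      {p : ℝ × ℝ | p.2 < p.1}.indicator (fun p => deriv η p.1 • g p.2) (x, y)) =
      -(η y • g y) := by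
    intro y hy
    have e : (fun x => {p : ℝ × ℝ | p.2 < p.1}.indicator (fun p => deriv η p.1 • g p.2) (x, y)) =
        (Ioi y).indicator fun x => deriv η x • g y := by
      funext x
      simp [indicator]
    have e' : Ioc 0 M ∩ Ioi y = Ioc y M := by
      ext x
      simp only [mem_inter_iff, mem_Ioc, mem_Ioi]
      exact ⟨fun h => ⟨h.2, h.1.2⟩, fun h => ⟨⟨hy.1.trans h.1, h.2⟩, h.1⟩⟩
    rw [e, setIntegral_indicator measurableSet_Ioi, e', integral_smul_const,
      ← intervalIntegral.integral_of_le hy.2,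
      intervalIntegral.integral_deriv_eq_sub (fun x _ => (hη.differentiable (by simp)) x)
        (hd.intervalIntegrable _ _), (hz M le_rfl).1, zero_sub, neg_smul]
  rw [setIntegral_congr_fun measurableSet_Ioc e1, setIntegral_congr_fun measurableSet_Ioc e2,
    integral_neg] at hswap
  exact hswap

lemma continuousOn_primitive_Ici {g : ℝ → ℂ} (hg : ∀ M, IntegrableOn g (Icc 0 M)) :
    ContinuousOn (fun x => ∫ y in (0 : ℝ)..x, g y) (Ici 0) := by
  intro x hx
  have h1 : ContinuousOn (fun x => ∫ y in (0 : ℝ)..x, g y) (uIcc 0 (x + 1)) :=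
    intervalIntegral.continuousOn_primitive_interval
      (by rw [uIcc_of_le (by linarith [mem_Ici.mp hx])]; exact hg _)
  rw [uIcc_of_le (by linarith [mem_Ici.mp hx])] at h1
  refine (h1 x ⟨hx, by linarith⟩).mono_of_mem_nhdsWithin ?_
  rw [← Ici_inter_Iic]
  exact inter_mem_nhdsWithin _ (Iic_mem_nhds (by linarith))

lemma tendsto_primitive_zero {g : ℝ → ℂ} (hg : ∀ M, IntegrableOn g (Icc 0 M)) :
    Tendsto (fun x => ∫ y in (0 : ℝ)..x, g y) (𝓝[>] 0) (𝓝 0) := by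
  have := (continuousOn_primitive_Ici hg 0 self_mem_Ici).mono Ioi_subset_Ici_self
  simpa [ContinuousWithinAt] using this

/-- A function on the half-line whose weak derivative vanishes is constant. -/
lemma ae_eq_const_of_integral_deriv_smul_eq_zero {f : ℝ → ℂ}
    (hf : LocallyIntegrableOn f (Ioi 0))
    (h : ∀ η : ℝ → ℝ, ContDiff ℝ ∞ η → HasCompactSupport η → tsupport η ⊆ Ioi 0 →
      ∫ x in Ioi (0 : ℝ), deriv η x • f x = 0) :
    ∃ c : ℂ, f =ᵐ[volume.restrict (Ioi (0 : ℝ))] fun _ => c := by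
  have hint : ∀ u : ℝ → ℝ, Continuous u → HasCompactSupport u → tsupport u ⊆ Ioi 0 →
      IntegrableOn (fun x => u x • f x) (Ioi 0) := by
    intro u hu hc hs
    have h1 : IntegrableOn (fun x => u x • f x) (tsupport u) :=
      (hf.integrableOn_compact_subset hs hc).continuousOn_smul hu.continuousOn hc
    have h2 : Integrable fun x => u x • f x := by
      refine (integrableOn_iff_integrable_of_support_subset fun x hx => ?_).mp h1
      refine subset_tsupport u ?_
      intro h0
      exact hx (by simp [h0])
    exact h2.integrableOn
  -- A reference test function of integral `1` supported in `[1/2, 3/2]`; the constant will be the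
  -- mean of `f` against it.
  let b : ContDiffBump (1 : ℝ) := ⟨1 / 4, 1 / 2, by norm_num, by norm_num⟩
  set ψ : ℝ → ℝ := b.normed volume with hψ
  have hψs : ContDiff ℝ ∞ ψ := b.contDiff_normed
  have hψc : HasCompactSupport ψ := b.hasCompactSupport_normed
  have hψt : tsupport ψ ⊆ Ioi 0 := by
    rw [hψ, b.tsupport_normed_eq]
    intro x hx
    rw [Metric.mem_closedBall, Real.dist_eq] at hx
    have : |x - 1| ≤ 1 / 2 := hx
    rw [abs_le] at this
    exact mem_Ioi.mpr (by linarith)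
  have hψ1 : ∫ x, ψ x = 1 := b.integral_normed
  refine ⟨∫ x in Ioi (0 : ℝ), ψ x • f x, ?_⟩
  set c := ∫ x in Ioi (0 : ℝ), ψ x • f x with hcdef
  have key := isOpen_Ioi.ae_eq_zero_of_integral_contDiff_smul_eq_zero (μ := volume)
    (f := fun x => f x - c) (U := Ioi (0 : ℝ))
    (hf.sub ((locallyIntegrable_const c).locallyIntegrableOn _)) ?_
  · refine (ae_restrict_iff' measurableSet_Ioi).mpr ?_
    filter_upwards [key] with x hx h0
    exact sub_eq_zero.mp (hx h0)
  intro u hu huc hus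
  set m := ∫ x, u x with hm
  -- Subtracting `m ψ` makes the integral of `v` vanish, so the primitive of `v` is again a test
  -- function supported in `(0,∞)` and the hypothesis applies to it.
  set v : ℝ → ℝ := fun x => u x - m * ψ x with hv
  have hvs : ContDiff ℝ ∞ v := hu.sub (contDiff_const.mul hψs)
  have hvt : tsupport v ⊆ tsupport u ∪ tsupport ψ := by
    refine closure_minimal (fun x hx => ?_) ((isClosed_tsupport u).union (isClosed_tsupport ψ))
    by_contra hn
    rw [mem_union, not_or] at hn
    exact hx (by simp [hv, image_eq_zero_of_notMem_tsupport hn.1,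
      image_eq_zero_of_notMem_tsupport hn.2])
  have hK : IsCompact (tsupport u ∪ tsupport ψ) := huc.isCompact.union hψc.isCompact
  have hKs : tsupport u ∪ tsupport ψ ⊆ Ioi 0 := union_subset hus hψt
  have hne : (tsupport u ∪ tsupport ψ).Nonempty := by
    refine Nonempty.inr ?_
    by_contra hn
    rw [not_nonempty_iff_eq_empty, tsupport_eq_empty_iff] at hn
    rw [hn] at hψ1
    simp at hψ1
  -- The interval `[α, β]` with `α > 0` contains the support of `v`. The primitive vanishes to its
  -- left trivially, and to its right because `v` has integral zero.
  obtain ⟨α, hα, hαl⟩ := hK.exists_isLeast hne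
  obtain ⟨β, hβ, hβl⟩ := hK.exists_isGreatest hne
  have hα0 : 0 < α := hKs hα
  have hvz : ∀ x, x ∉ Icc α β → v x = 0 := fun x hx =>
    image_eq_zero_of_notMem_tsupport fun h => hx ⟨hαl (hvt h), hβl (hvt h)⟩
  have hv0 : ∫ x, v x = 0 := by
    rw [hv, integral_sub (hu.continuous.integrable_of_hasCompactSupport huc)
      ((hψs.continuous.integrable_of_hasCompactSupport hψc).const_mul m), integral_const_mul, hψ1]
    simp [hm]
  set η : ℝ → ℝ := fun x => ∫ y in (0 : ℝ)..x, v y with hη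
  have hder : ∀ x, HasDerivAt η (v x) x := fun x =>
    intervalIntegral.integral_hasDerivAt_right (hvs.continuous.intervalIntegrable _ _)
      (hvs.continuous.stronglyMeasurableAtFilter _ _) hvs.continuous.continuousAt
  have hderiv : deriv η = v := funext fun x => (hder x).deriv
  have hηs : ContDiff ℝ ∞ η := by
    refine contDiff_infty_iff_deriv.mpr ⟨fun x => (hder x).differentiableAt, ?_⟩
    rw [hderiv]
    exact hvs
  have hηz : ∀ x, x ∉ Icc α β → η x = 0 := by
    intro x hx
    rw [mem_Icc, not_and_or, not_le, not_le] at hx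
    rcases hx with hx | hx
    · refine intervalIntegral.integral_zero_ae (Eventually.of_forall fun y hy => hvz y fun hy' => ?_)
      have := (mem_uIoc.mp hy)
      rcases this with h | h
      · linarith [h.2, hy'.1]
      · linarith [h.2, hy'.1]
    · have e : ∫ y in (0 : ℝ)..x, v y = ∫ y, v y := by
        refine intervalIntegral.integral_eq_integral_of_support_subset fun y hy => ?_
        by_contra hn
        refine hy (hvz y fun hy' => hn ⟨hα0.trans_le hy'.1, hy'.2.trans hx.le⟩)
      rw [hη]
      exact e.trans hv0
  have hηc : HasCompactSupport η := HasCompactSupport.intro isCompact_Icc hηz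
  have hηt : tsupport η ⊆ Ioi 0 := by
    have h1 : tsupport η ⊆ Icc α β := closure_minimal
      (fun x hx => by_contra fun hn => hx (hηz x hn)) isClosed_Icc
    exact fun x hx => hα0.trans_le (h1 hx).1
  have h0 := h η hηs hηc hηt
  rw [hderiv] at h0
  have e1 : ∫ x in Ioi (0 : ℝ), v x • f x = (∫ x in Ioi (0 : ℝ), u x • f x) - m • c := by
    have hi : IntegrableOn (fun x => m • ψ x • f x) (Ioi 0) :=
      (hint ψ hψs.continuous hψc hψt).smul m
    rw [hcdef, ← integral_smul, ← integral_sub (hint u hu.continuous huc hus) hi]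
    refine integral_congr_ae (Eventually.of_forall fun x => ?_)
    simp only [hv, sub_smul, mul_smul]
  have e2 : ∫ x, u x • (f x - c) = (∫ x in Ioi (0 : ℝ), u x • f x) - m • c := by
    have e3 : ∫ x in Ioi (0 : ℝ), u x = m := by
      rw [hm]
      exact setIntegral_eq_integral_of_forall_compl_eq_zero fun x hx =>
        image_eq_zero_of_notMem_tsupport fun h => hx (hus h)
    rw [← setIntegral_eq_integral_of_forall_compl_eq_zero (s := Ioi (0 : ℝ)) fun x hx => by
      rw [image_eq_zero_of_notMem_tsupport fun h => hx (hus h), zero_smul]]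
    simp only [smul_sub]
    rw [integral_sub (hint u hu.continuous huc hus)
      (((hu.continuous.integrable_of_hasCompactSupport huc).integrableOn).smul_const c),
      integral_smul_const, e3]
  rw [e2, ← e1, h0]

/-- Functions with a weak derivative on the half-line are primitives. -/
lemma IsWeakDeriv.ae_eq_primitive {f g : ℝ → ℂ}
    (hf : MemLp f 2 (volume.restrict (Ioi (0 : ℝ)))) (hg : ∀ M, IntegrableOn g (Icc 0 M))
    (h : IsWeakDeriv (Ioi 0) f g) :
    ∃ C : ℂ, f =ᵐ[volume.restrict (Ioi (0 : ℝ))] fun x => C + ∫ y in (0 : ℝ)..x, g y := by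
  have hfl : LocallyIntegrableOn f (Ioi 0) :=
    locallyIntegrableOn_of_locallyIntegrable_restrict (hf.locallyIntegrable (by norm_num))
  have hG := continuousOn_primitive_Ici hg
  obtain ⟨C, hC⟩ := ae_eq_const_of_integral_deriv_smul_eq_zero
    (f := fun x => f x - ∫ y in (0 : ℝ)..x, g y)
    (hfl.sub ((hG.mono Ioi_subset_Ici_self).locallyIntegrableOn measurableSet_Ioi)) (by
      intro η h1 h2 h3
      have hi : IntegrableOn (fun x => deriv η x • ∫ y in (0 : ℝ)..x, g y) (Ioi 0) := by
        obtain ⟨M, hM, hz⟩ := exists_pos_forall_ge_eq_zero h2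
        have hd : Continuous (deriv η) := h1.continuous_deriv (by simp)
        have h4 : IntegrableOn (fun x => deriv η x • ∫ y in (0 : ℝ)..x, g y) (Icc 0 M) :=
          (hd.continuousOn.smul (hG.mono Icc_subset_Ici_self)).integrableOn_Icc
        refine h4.of_forall_sdiff_eq_zero measurableSet_Ioi fun x hx => ?_
        rw [(hz x (by
          by_contra hn
          exact hx.2 ⟨(mem_Ioi.mp hx.1).le, (not_le.mp hn).le⟩)).2, zero_smul]
      simp only [smul_sub]
      rw [integral_sub (integrable_deriv_smul_of_L2 hf h1 h2) hi, integral_deriv_smul_primitive hg h1 h2, h η h1 h2 h3,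
        sub_self])
  refine ⟨C, ?_⟩
  filter_upwards [hC] with x hx
  rw [← hx]
  ring

/-- Weak product rule. -/
lemma IsWeakDeriv.mul_smooth {f g : ℝ → ℂ} {w : ℝ → ℝ} {Ω : Set ℝ}
    (hf : MemLp f 2 (volume.restrict Ω)) (hg : MemLp g 2 (volume.restrict Ω))
    (hw : ContDiff ℝ ∞ w) (h : IsWeakDeriv Ω f g) :
    IsWeakDeriv Ω (fun x => w x • f x) (fun x => w x • g x + deriv w x • f x) := by
  intro η h1 h2 h3
  have hwd : Continuous (deriv w) := hw.continuous_deriv (by simp)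
  have hηd : Continuous (deriv η) := h1.continuous_deriv (by simp)
  have e := h (fun x => η x * w x) (h1.mul hw) h2.mul_right
    ((tsupport_mul_subset_left).trans h3)
  have hd : ∀ x, deriv (fun x => η x * w x) x = deriv η x * w x + η x * deriv w x := fun x =>
    deriv_fun_mul (h1.differentiable (by simp) x) (hw.differentiable (by simp) x)
  simp only [hd, add_smul] at e
  have i1 : Integrable (fun x => (deriv η x * w x) • f x) (volume.restrict Ω) :=
    integrable_smul_of_L2 hf (hηd.mul hw.continuous) (h2.deriv.mul_right (f' := w))
  have i2 : Integrable (fun x => (η x * deriv w x) • f x) (volume.restrict Ω) :=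
    integrable_smul_of_L2 hf (h1.continuous.mul hwd) (h2.mul_right (f' := deriv w))
  have i3 : Integrable (fun x => (η x * w x) • g x) (volume.restrict Ω) :=
    integrable_smul_of_L2 hg (h1.continuous.mul hw.continuous) (h2.mul_right (f' := w))
  rw [integral_add i1 i2] at e
  simp only [smul_add, ← mul_smul]
  rw [integral_add i3 i2]
  linear_combination e

/-! ### Boundary values on the half-line -/

/-- `g` is the weak derivative of `f` on the half-line and `f(0+) = a`, expressed by integration by
parts against test functions that need not vanish at the origin. -/
def IsWeakDerivTrace (f g : ℝ → ℂ) (a : ℂ) : Prop :=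
  ∀ η : ℝ → ℝ, ContDiff ℝ ∞ η → HasCompactSupport η →
    ∫ x in Ioi (0 : ℝ), deriv η x • f x = -(η 0 • a) - ∫ x in Ioi (0 : ℝ), η x • g x

lemma IsWeakDerivTrace.congr {f f' g g' : ℝ → ℂ} {a : ℂ} (h : IsWeakDerivTrace f g a)
    (hf : f' =ᵐ[volume.restrict (Ioi (0 : ℝ))] f) (hg : g' =ᵐ[volume.restrict (Ioi (0 : ℝ))] g) :
    IsWeakDerivTrace f' g' a := by
  intro η h1 h2
  have e1 : ∫ x in Ioi (0 : ℝ), deriv η x • f' x = ∫ x in Ioi (0 : ℝ), deriv η x • f x :=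
    integral_congr_ae (by filter_upwards [hf] with x hx; rw [hx])
  have e2 : ∫ x in Ioi (0 : ℝ), η x • g' x = ∫ x in Ioi (0 : ℝ), η x • g x :=
    integral_congr_ae (by filter_upwards [hg] with x hx; rw [hx])
  rw [e1, e2, h η h1 h2]

lemma IsWeakDerivTrace.add {f f' g g' : ℝ → ℂ} {a a' : ℂ}
    (hf : MemLp f 2 (volume.restrict (Ioi 0))) (hf' : MemLp f' 2 (volume.restrict (Ioi 0)))
    (hg : MemLp g 2 (volume.restrict (Ioi 0))) (hg' : MemLp g' 2 (volume.restrict (Ioi 0)))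
    (h : IsWeakDerivTrace f g a) (h' : IsWeakDerivTrace f' g' a') :
    IsWeakDerivTrace (f + f') (g + g') (a + a') := by
  intro η h1 h2
  simp only [Pi.add_apply, smul_add]
  rw [integral_add (integrable_deriv_smul_of_L2 hf h1 h2) (integrable_deriv_smul_of_L2 hf' h1 h2),
    integral_add (integrable_smul_of_L2 hg h1.continuous h2)
      (integrable_smul_of_L2 hg' h1.continuous h2), h η h1 h2, h' η h1 h2]
  ring

lemma IsWeakDerivTrace.smul {f g : ℝ → ℂ} {a : ℂ} (c : ℂ) (h : IsWeakDerivTrace f g a) :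
    IsWeakDerivTrace (c • f) (c • g) (c • a) := by
  intro η h1 h2
  simp only [Pi.smul_apply, smul_comm _ c, integral_smul]
  rw [h η h1 h2, smul_sub, smul_neg]

lemma IsWeakDerivTrace.isWeakDeriv {f g : ℝ → ℂ} {a : ℂ} (h : IsWeakDerivTrace f g a) :
    IsWeakDeriv (Ioi 0) f g := by
  intro η h1 h2 h3
  have h0 : η 0 = 0 := image_eq_zero_of_notMem_tsupport fun hx => lt_irrefl _ (mem_Ioi.mp (h3 hx))
  rw [h η h1 h2, h0, zero_smul, neg_zero, zero_sub]

lemma exists_testFunction_one :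
    ∃ η : ℝ → ℝ, ContDiff ℝ ∞ η ∧ HasCompactSupport η ∧ η 0 = 1 := by
  obtain ⟨η, -, h1, h2, -, h3⟩ :=
    exists_contDiff_tsupport_subset (E := ℝ) (s := univ) (x := 0) (n := ⊤) univ_mem
  exact ⟨η, h2, h1, h3⟩

/-- Write `f` as a constant `C` plus the primitive of `g`. Integrating by parts against a test
function with `η 0 = 1` shows `C = a`. -/
lemma IsWeakDerivTrace.hasValueAtZero {f g : ℝ → ℂ} {a : ℂ}
    (hf : MemLp f 2 (volume.restrict (Ioi (0 : ℝ)))) (hg : MemLp g 2 (volume.restrict (Ioi (0 : ℝ))))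
    (h : IsWeakDerivTrace f g a) : HasValueAtZero (Ioi 0) f a := by
  have hgi := MemLp.integrableOn_Icc hg
  obtain ⟨C, hC⟩ := h.isWeakDeriv.ae_eq_primitive hf hgi
  obtain ⟨η, h1, h2, h3⟩ := exists_testFunction_one
  have hd : Continuous (deriv η) := h1.continuous_deriv (by simp)
  have i1 : Integrable (fun x => deriv η x • C) (volume.restrict (Ioi (0 : ℝ))) :=
    ((hd.integrable_of_hasCompactSupport h2.deriv).integrableOn).smul_const C
  have i2 : Integrable (fun x => deriv η x • ∫ y in (0 : ℝ)..x, g y)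
      (volume.restrict (Ioi (0 : ℝ))) := by
    refine ((integrable_deriv_smul_of_L2 hf h1 h2).sub i1).congr ?_
    filter_upwards [hC] with x hx
    rw [Pi.sub_apply, hx, smul_add, add_sub_cancel_left]
  have e := h η h1 h2
  have e' : ∫ x in Ioi (0 : ℝ), deriv η x • f x = -(η 0 • C) - ∫ x in Ioi (0 : ℝ), η x • g x := by
    have e1 : ∫ x in Ioi (0 : ℝ), deriv η x • f x =
        ∫ x in Ioi (0 : ℝ), (deriv η x • C + deriv η x • ∫ y in (0 : ℝ)..x, g y) :=
      integral_congr_ae (by filter_upwards [hC] with x hx; rw [hx, smul_add])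
    rw [e1, integral_add i1 i2, integral_smul_const,
      h2.integral_Ioi_deriv_eq (h1.of_le (by simp)) 0, integral_deriv_smul_primitive hgi h1 h2,
      neg_smul]
    ring
  rw [e, h3, one_smul, one_smul] at e'
  have hCa : C = a := by linear_combination e'
  refine ⟨_, ?_, hC, ?_⟩
  · exact continuousOn_const.add ((continuousOn_primitive_Ici hgi).mono Ioi_subset_Ici_self)
  · simpa [hCa] using (tendsto_const_nhds (x := C)).add (tendsto_primitive_zero hgi)

lemma HasValueAtZero.unique {f : ℝ → ℂ} {a b : ℂ} (ha : HasValueAtZero (Ioi 0) f a)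
    (hb : HasValueAtZero (Ioi 0) f b) : a = b := by
  obtain ⟨F, h1, h2, h3⟩ := ha
  obtain ⟨G, k1, k2, k3⟩ := hb
  have h : EqOn F G (Ioi 0) :=
    Measure.eqOn_open_of_ae_eq (h2.symm.trans k2) isOpen_Ioi h1 k1
  refine tendsto_nhds_unique h3 (k3.congr' ?_)
  filter_upwards [self_mem_nhdsWithin] with x hx
  exact (h hx).symm

/-! ### The decaying exponential -/

lemma memLp_exp_neg {m : ℝ} (hm : 0 < m) :
    MemLp (fun x : ℝ => Real.exp (-m * x)) 2 (volume.restrict (Ioi (0 : ℝ))) := by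
  rw [memLp_two_iff_integrable_sq (by fun_prop)]
  have h := exp_neg_integrableOn_Ioi 0 (b := 2 * m) (by positivity)
  refine Integrable.congr h (Eventually.of_forall fun x => ?_)
  simp only
  rw [sq, ← Real.exp_add]
  congr 1
  ring

lemma memLp_exp_neg_ofReal {m : ℝ} (hm : 0 < m) :
    MemLp (fun x : ℝ => (Real.exp (-m * x) : ℂ)) 2 (volume.restrict (Ioi (0 : ℝ))) :=
  (memLp_exp_neg hm).ofReal

lemma integrable_exp_neg_smul {m : ℝ} (hm : 0 < m) {h : ℝ → ℂ}
    (hh : MemLp h 2 (volume.restrict (Ioi (0 : ℝ)))) :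
    Integrable (fun x => Real.exp (-m * x) • h x) (volume.restrict (Ioi (0 : ℝ))) :=
  memLp_one_iff_integrable.mp (hh.smul (memLp_exp_neg hm))

lemma memLp_exp_neg_smul {m : ℝ} (hm : 0 < m) {h : ℝ → ℂ}
    (hh : MemLp h 2 (volume.restrict (Ioi (0 : ℝ)))) :
    MemLp (fun x => Real.exp (-m * x) • h x) 2 (volume.restrict (Ioi (0 : ℝ))) := by
  refine hh.of_le ((by fun_prop : Continuous fun x : ℝ =>
    Real.exp (-m * x)).aestronglyMeasurable.smul hh.1) ?_
  filter_upwards [ae_restrict_mem measurableSet_Ioi] with x hx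
  rw [norm_smul, Real.norm_eq_abs, Real.abs_exp]
  have : Real.exp (-m * x) ≤ 1 := Real.exp_le_one_iff.mpr (by nlinarith [mem_Ioi.mp hx])
  nlinarith [norm_nonneg (h x)]

lemma contDiff_exp_mul (m : ℝ) : ContDiff ℝ ∞ fun x : ℝ => Real.exp (m * x) :=
  Real.contDiff_exp.comp (contDiff_const.mul contDiff_id)

lemma deriv_exp_mul (m x : ℝ) : deriv (fun x : ℝ => Real.exp (m * x)) x = m * Real.exp (m * x) := by
  have h : HasDerivAt (fun x : ℝ => Real.exp (m * x)) (Real.exp (m * x) * (m * 1)) x :=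
    ((hasDerivAt_id x).const_mul m).exp
  rw [h.deriv]
  ring

/-- The square-integrable solution of `p' = m p - h`. -/
lemma ae_eq_of_isWeakDeriv_growth {m : ℝ} (hm : 0 < m) {p h : ℝ → ℂ}
    (hp : MemLp p 2 (volume.restrict (Ioi (0 : ℝ)))) (hh : MemLp h 2 (volume.restrict (Ioi (0 : ℝ))))
    (hd : IsWeakDeriv (Ioi 0) p fun x => m • p x - h x) :
    p =ᵐ[volume.restrict (Ioi (0 : ℝ))] fun x => Real.exp (m * x) •
      ((∫ y in Ioi (0 : ℝ), Real.exp (-m * y) • h y) -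
        ∫ y in (0 : ℝ)..x, Real.exp (-m * y) • h y) := by
  -- With the integrating factor, `exp (-m x) p` has weak derivative `-exp (-m x) h`, so it is a
  -- primitive up to a constant `C`.
  have hq := IsWeakDeriv.mul_smooth hp ((hp.const_smul m).sub hh) (contDiff_exp_mul (-m)) hd
  have hint := integrable_exp_neg_smul hm hh
  have hI : ∀ M, IntegrableOn (fun y => -(Real.exp (-m * y) • h y)) (Icc 0 M) := fun M => by
    rw [integrableOn_Icc_iff_integrableOn_Ioc]
    exact hint.neg.mono_measure (Measure.restrict_mono Ioc_subset_Ioi_self le_rfl)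
  obtain ⟨C, hC⟩ := (hq.congr ae_eq_rfl (g' := fun y => -(Real.exp (-m * y) • h y))
    (Eventually.of_forall fun x => by
      simp only [Pi.sub_apply, Pi.smul_apply, deriv_exp_mul]
      module)).ae_eq_primitive (memLp_exp_neg_smul hm hp) hI
  have hlim : Tendsto (fun x => C + ∫ y in (0 : ℝ)..x, -(Real.exp (-m * y) • h y)) atTop
      (𝓝 (C + ∫ y in Ioi (0 : ℝ), -(Real.exp (-m * y) • h y))) :=
    tendsto_const_nhds.add (intervalIntegral_tendsto_integral_Ioi 0 hint.neg tendsto_id)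
  have hat : IntegrableAtFilter (fun x => C + ∫ y in (0 : ℝ)..x, -(Real.exp (-m * y) • h y))
      atTop volume :=
    ⟨Ioi 0, Ioi_mem_atTop 0, (integrable_exp_neg_smul hm hp).congr hC⟩
  -- An integrable function with a limit at infinity has limit zero, which fixes `C`.
  have hzero := hat.eq_zero_of_tendsto (fun s hs => by
    obtain ⟨a, ha⟩ := mem_atTop_sets.mp hs
    exact measure_mono_top (fun x hx => ha x hx) (Real.volume_Ici (a := a))) hlim
  rw [integral_neg] at hzero
  have hC' : C = ∫ y in Ioi (0 : ℝ), Real.exp (-m * y) • h y := by linear_combination hzero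
  filter_upwards [hC] with x hx
  rw [intervalIntegral.integral_neg, ← sub_eq_add_neg, hC'] at hx
  rw [← hx, ← mul_smul, ← Real.exp_add]
  simp

/-- If `f'' = m² f - h`, then `p = f' + m f` satisfies `p' = m p - h`. As `p` is square-integrable,
its boundary value is forced by `h`; this yields `f'(0+)` for the resolvent without an explicit
kernel. -/
lemma hasValueAtZero_of_isWeakDeriv_growth {m : ℝ} (hm : 0 < m) {p h : ℝ → ℂ}
    (hp : MemLp p 2 (volume.restrict (Ioi (0 : ℝ)))) (hh : MemLp h 2 (volume.restrict (Ioi (0 : ℝ))))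
    (hd : IsWeakDeriv (Ioi 0) p fun x => m • p x - h x) :
    HasValueAtZero (Ioi 0) p (∫ y in Ioi (0 : ℝ), Real.exp (-m * y) • h y) := by
  have hI : ∀ M, IntegrableOn (fun y => Real.exp (-m * y) • h y) (Icc 0 M) := fun M => by
    rw [integrableOn_Icc_iff_integrableOn_Ioc]
    exact (integrable_exp_neg_smul hm hh).mono_measure
      (Measure.restrict_mono Ioc_subset_Ioi_self le_rfl)
  have hexp : Continuous fun x : ℝ => Real.exp (m * x) := by fun_prop
  refine ⟨_, ?_, ae_eq_of_isWeakDeriv_growth hm hp hh hd, ?_⟩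
  · exact hexp.continuousOn.smul (continuousOn_const.sub
      ((continuousOn_primitive_Ici hI).mono Ioi_subset_Ici_self))
  · have h1 : Tendsto (fun x : ℝ => Real.exp (m * x)) (𝓝[>] 0) (𝓝 1) := by
      simpa using (hexp.tendsto 0).mono_left nhdsWithin_le_nhds
    simpa using h1.smul ((tendsto_const_nhds
      (x := ∫ y in Ioi (0 : ℝ), Real.exp (-m * y) • h y)).sub (tendsto_primitive_zero hI))

/-- The square-integrable solutions of `f'' = m² f` on the half-line are multiples of
`exp (-m x)`. -/
lemma ae_eq_exp_neg_of_isWeakDeriv {m : ℝ} (hm : 0 < m) {f g : ℝ → ℂ}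
    (hf : MemLp f 2 (volume.restrict (Ioi (0 : ℝ)))) (hg : MemLp g 2 (volume.restrict (Ioi (0 : ℝ))))
    (hfg : IsWeakDeriv (Ioi 0) f g) (hgf : IsWeakDeriv (Ioi 0) g fun x => m ^ 2 • f x) :
    ∃ c : ℂ, f =ᵐ[volume.restrict (Ioi (0 : ℝ))] (fun x => Real.exp (-m * x) • c) ∧
      g =ᵐ[volume.restrict (Ioi (0 : ℝ))] fun x => Real.exp (-m * x) • (-m * c) := by
  have hmf : MemLp ((m : ℂ) • f) 2 (volume.restrict (Ioi (0 : ℝ))) := hf.const_smul (m : ℂ)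
  have hmg : MemLp ((m : ℂ) • g) 2 (volume.restrict (Ioi (0 : ℝ))) := hg.const_smul (m : ℂ)
  have hm2 : MemLp (fun x => m ^ 2 • f x) 2 (volume.restrict (Ioi (0 : ℝ))) :=
    hf.const_smul (m ^ 2)
  -- Factorisation of `∂² - m²`: the combination `g + m f` solves `p' = m p` in `L²`, so it
  -- vanishes. This leaves `f' = -m f`, whence `exp (m x) f` is constant.
  have hp : IsWeakDeriv (Ioi 0) (g + (m : ℂ) • f) fun x => m • (g + (m : ℂ) • f) x - (0 : ℂ) := by
    refine (IsWeakDeriv.add hg hmf hm2 hmg hgf (hfg.smul (m : ℂ))).congr ae_eq_rfl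
      (Eventually.of_forall fun x => ?_)
    simp only [Pi.add_apply, Pi.smul_apply, smul_eq_mul, Complex.real_smul, Complex.ofReal_pow]
    ring
  have hz := ae_eq_of_isWeakDeriv_growth hm (hg.add hmf) MemLp.zero hp
  have hgm : g =ᵐ[volume.restrict (Ioi (0 : ℝ))] fun x => -(m • f x) := by
    filter_upwards [hz] with x hx
    simp only [Pi.add_apply, Pi.smul_apply, Pi.zero_apply, smul_zero, integral_zero,
      intervalIntegral.integral_zero, sub_zero, smul_eq_mul] at hx
    rw [Complex.real_smul]
    linear_combination hx
  have hw := IsWeakDeriv.mul_smooth hf (hf.const_smul m).neg (contDiff_exp_mul m)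
    (hfg.congr ae_eq_rfl hgm.symm)
  have hloc : LocallyIntegrableOn f (Ioi 0) :=
    locallyIntegrableOn_of_locallyIntegrable_restrict (hf.locallyIntegrable (by norm_num))
  obtain ⟨c, hc⟩ := ae_eq_const_of_integral_deriv_smul_eq_zero
    (f := fun x => Real.exp (m * x) • f x)
    (hloc.continuousOn_smul isOpen_Ioi.isLocallyClosed (contDiff_exp_mul m).continuous.continuousOn)
    (fun η h1 h2 h3 => by
      rw [hw η h1 h2 h3, neg_eq_zero]
      refine integral_eq_zero_of_ae (Eventually.of_forall fun x => ?_)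
      simp only [deriv_exp_mul, Pi.neg_apply, Pi.smul_apply, Pi.zero_apply]
      module)
  have hfc : f =ᵐ[volume.restrict (Ioi (0 : ℝ))] fun x => Real.exp (-m * x) • c := by
    filter_upwards [hc] with x hx
    rw [← hx, ← mul_smul, ← Real.exp_add]
    simp
  refine ⟨c, hfc, ?_⟩
  filter_upwards [hgm, hfc] with x h1 h2
  rw [h1, h2]
  simp only [Complex.real_smul]
  ring

lemma hasValueAtZero_exp_neg (m : ℝ) (c : ℂ) :
    HasValueAtZero (Ioi 0) (fun x => Real.exp (-m * x) • c) c := by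
  have h : Continuous fun x : ℝ => Real.exp (-m * x) • c := by fun_prop
  refine ⟨_, h.continuousOn, ae_eq_rfl, ?_⟩
  simpa using (h.tendsto 0).mono_left nhdsWithin_le_nhds

/-- The function `exp (-m x)` as an element of `L²(0,∞)`. -/
def decay {m : ℝ} (hm : 0 < m) : L2Half := (memLp_exp_neg_ofReal hm).toLp _

lemma coeFn_decay {m : ℝ} (hm : 0 < m) :
    decay hm =ᵐ[volume.restrict (Ioi (0 : ℝ))] fun x => (Real.exp (-m * x) : ℂ) :=
  MemLp.coeFn_toLp _

lemma inner_decay {m : ℝ} (hm : 0 < m) (h : L2Half) :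
    inner ℂ (decay hm) h = ∫ x in Ioi (0 : ℝ), Real.exp (-m * x) • h x := by
  rw [L2.inner_def]
  refine integral_congr_ae ?_
  filter_upwards [coeFn_decay hm] with x hx
  rw [hx, RCLike.inner_apply, Complex.conj_ofReal, Complex.real_smul, mul_comm]

lemma isWeakDerivTrace_exp_neg {m : ℝ} (hm : 0 < m) :
    IsWeakDerivTrace (fun x => (Real.exp (-m * x) : ℂ)) (fun x => -m * (Real.exp (-m * x) : ℂ)) 1 := by
  intro η h1 h2
  have hL := memLp_exp_neg_ofReal hm
  have i1 := integrable_deriv_smul_of_L2 hL h1 h2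
  have i2 : Integrable (fun x => η x • (-m * (Real.exp (-m * x) : ℂ)))
      (volume.restrict (Ioi (0 : ℝ))) :=
    integrable_smul_of_L2 (hL.const_mul (-m : ℂ)) h1.continuous h2
  have hs : ContDiff ℝ ∞ fun x => η x * Real.exp (-m * x) := h1.mul (contDiff_exp_mul (-m))
  have e := (h2.mul_right (f' := fun x : ℝ => Real.exp (-m * x))).integral_Ioi_deriv_eq
    (hs.of_le (by simp)) 0
  have hd : ∀ x, deriv (fun x => η x * Real.exp (-m * x)) x =
      deriv η x * Real.exp (-m * x) + η x * (-m * Real.exp (-m * x)) := fun x => by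
    rw [deriv_fun_mul (h1.differentiable (by simp) x)
      ((contDiff_exp_mul (-m)).differentiable (by simp) x), deriv_exp_mul]
  simp only [hd, mul_zero, Real.exp_zero, mul_one] at e
  have e' := congrArg (fun r : ℝ => (r : ℂ)) e
  simp only [← integral_complex_ofReal] at e'
  rw [eq_sub_iff_add_eq, ← integral_add i1 i2]
  refine Eq.trans ?_ (e'.trans (by simp))
  refine integral_congr_ae (Eventually.of_forall fun x => ?_)
  simp only [Complex.real_smul]
  push_cast
  ring

/-! ### The resolvent of the Laplacian on the half-line -/

/-- A continuous compactly supported function as an element of `L²(0,∞)`. -/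
def testL2 {η : ℝ → ℝ} (hη : Continuous η) (hc : HasCompactSupport η) : L2Half :=
  (hη.memLp_of_hasCompactSupport hc (μ := volume.restrict (Ioi (0 : ℝ))) (p := 2)).ofReal.toLp
    fun x => (η x : ℂ)

lemma coeFn_testL2 {η : ℝ → ℝ} (hη : Continuous η) (hc : HasCompactSupport η) :
    testL2 hη hc =ᵐ[volume.restrict (Ioi (0 : ℝ))] fun x => (η x : ℂ) := MemLp.coeFn_toLp _

lemma inner_testL2 {η : ℝ → ℝ} (hη : Continuous η) (hc : HasCompactSupport η) (f : L2Half) :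
    inner ℂ (testL2 hη hc) f = ∫ x in Ioi (0 : ℝ), η x • f x := by
  rw [L2.inner_def]
  refine integral_congr_ae ?_
  filter_upwards [coeFn_testL2 hη hc] with x hx
  rw [hx, RCLike.inner_apply, Complex.conj_ofReal, Complex.real_smul, mul_comm]

/-- The pairs `(f, g)` of functions on the half-line with `f' = m g` and `f(0) = 0`, as a closed
subspace. -/
def dirichletSpace (m : ℝ) : Submodule ℂ (WithLp 2 (L2Half × L2Half)) :=
  (Submodule.span ℂ {u | ∃ (η : ℝ → ℝ) (h1 : ContDiff ℝ ∞ η) (h2 : HasCompactSupport η),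
    u = WithLp.toLp 2 (testL2 (h1.continuous_deriv (by simp)) h2.deriv,
      (m : ℂ) • testL2 h1.continuous h2)})ᗮ

lemma mem_dirichletSpace (m : ℝ) (v : WithLp 2 (L2Half × L2Half)) :
    v ∈ dirichletSpace m ↔ ∀ η : ℝ → ℝ, ContDiff ℝ ∞ η → HasCompactSupport η →
      (∫ x in Ioi (0 : ℝ), deriv η x • v.fst x) + m * ∫ x in Ioi (0 : ℝ), η x • v.snd x = 0 := by
  have hin : ∀ (η : ℝ → ℝ) (h1 : ContDiff ℝ ∞ η) (h2 : HasCompactSupport η),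
      inner ℂ (WithLp.toLp 2 (testL2 (h1.continuous_deriv (by simp)) h2.deriv,
        (m : ℂ) • testL2 h1.continuous h2)) v =
      (∫ x in Ioi (0 : ℝ), deriv η x • v.fst x) + m * ∫ x in Ioi (0 : ℝ), η x • v.snd x := by
    intro η h1 h2
    rw [WithLp.prod_inner_apply]
    simp only [inner_smul_left, Complex.conj_ofReal]
    rw [inner_testL2, inner_testL2]
    rfl
  constructor
  · intro hv η h1 h2
    rw [← hin η h1 h2]
    exact (Submodule.mem_orthogonal _ _).mp hv _ (Submodule.subset_span ⟨η, h1, h2, rfl⟩)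
  · intro hv
    refine (Submodule.mem_orthogonal _ _).mpr fun u hu => ?_
    rw [← Submodule.mem_orthogonal_singleton_iff_inner_left]
    refine Submodule.span_le.mpr ?_ hu
    rintro _ ⟨η, h1, h2, rfl⟩
    refine Submodule.mem_orthogonal_singleton_iff_inner_left.mpr ?_
    rw [hin η h1 h2, hv η h1 h2]

instance (m : ℝ) : (dirichletSpace m).HasOrthogonalProjection := by
  unfold dirichletSpace
  infer_instance

/-- The resolvent `(m² - ∂²)⁻¹` on the half-line with a Dirichlet condition. -/
def dirichletResolvent (m : ℝ) : L2Half →L[ℂ] L2Half :=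
  (((m ^ 2)⁻¹ : ℝ) : ℂ) • (WithLp.fstL 2 ℂ L2Half L2Half ∘L (dirichletSpace m).starProjection ∘L
    (WithLp.fstL 2 ℂ L2Half L2Half).adjoint)

/-- A compression of an orthogonal projection, scaled by a real number. -/
lemma isSelfAdjoint_dirichletResolvent (m : ℝ) : IsSelfAdjoint (dirichletResolvent m) :=
  IsSelfAdjoint.smul (Complex.conj_ofReal _)
    ((isSelfAdjoint_starProjection (dirichletSpace m)).conj_adjoint _)

/-- Project `(h, 0)` orthogonally onto the space of pairs with `w₁' = m w₂`, `w₁(0) = 0`.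
Orthogonality of the error to the pairs `(η, η'/m)` says weakly that `w₂' = m (w₁ - h)`. Hence `f =
w₁/m²` and `g = w₂/m` satisfy `f' = g` and `g' = m² f - h`. -/
lemma dirichletResolvent_spec {m : ℝ} (hm : 0 < m) (h : L2Half) :
    ∃ g : L2Half, IsWeakDerivTrace (dirichletResolvent m h) g 0 ∧
      IsWeakDeriv (Ioi 0) g fun x => m ^ 2 • dirichletResolvent m h x - h x := by
  set w := (dirichletSpace m).starProjection ((WithLp.fstL 2 ℂ L2Half L2Half).adjoint h) with hw
  have hwm : w ∈ dirichletSpace m := Submodule.starProjection_apply_mem _ _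
  have hf : dirichletResolvent m h = (((m ^ 2)⁻¹ : ℝ) : ℂ) • w.fst := rfl
  have hfc : dirichletResolvent m h =ᵐ[volume.restrict (Ioi (0 : ℝ))]
      fun x => ((m ^ 2)⁻¹ : ℝ) • w.fst x := by
    filter_upwards [Lp.coeFn_smul ((((m ^ 2)⁻¹ : ℝ) : ℂ)) w.fst] with x hx
    rw [hf, hx, Pi.smul_apply, Complex.real_smul, smul_eq_mul]
  have hgc : ⇑((m⁻¹ : ℝ) • w.snd) =ᵐ[volume.restrict (Ioi (0 : ℝ))] fun x => (m⁻¹ : ℝ) • w.snd x :=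
    Lp.coeFn_smul _ _
  have hm0 : (m : ℂ) ≠ 0 := by exact_mod_cast hm.ne'
  refine ⟨(m⁻¹ : ℝ) • w.snd, ?_, ?_⟩
  · refine IsWeakDerivTrace.congr (f := fun x => ((m ^ 2)⁻¹ : ℝ) • w.fst x)
      (g := fun x => (m⁻¹ : ℝ) • w.snd x) ?_ hfc hgc
    intro η h1 h2
    have e := (mem_dirichletSpace m w).mp hwm η h1 h2
    simp only [smul_comm _ ((m ^ 2)⁻¹ : ℝ), smul_comm _ (m⁻¹ : ℝ), integral_smul]
    rw [eq_neg_of_add_eq_zero_left e]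
    simp only [Complex.real_smul, mul_zero, neg_zero, zero_sub]
    push_cast
    field_simp
  · have hgoal : IsWeakDeriv (Ioi 0) (fun x => (m⁻¹ : ℝ) • w.snd x) fun x => w.fst x - h x := by
      intro η h1 h2 h3
      have hη0 : η 0 = 0 :=
        image_eq_zero_of_notMem_tsupport fun hx => lt_irrefl _ (mem_Ioi.mp (h3 hx))
      have hdc : Continuous (deriv η) := h1.continuous_deriv (by simp)
      set v : WithLp 2 (L2Half × L2Half) :=
        WithLp.toLp 2 (testL2 h1.continuous h2, ((m⁻¹ : ℝ) : ℂ) • testL2 hdc h2.deriv) with hv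
      -- Here `η 0 = 0` removes the boundary term in `∫ (ζ η)'`, where `ζ` is free at the origin.
      have hvm : v ∈ dirichletSpace m := by
        rw [mem_dirichletSpace]
        intro ζ k1 k2
        have e1 : ∫ x in Ioi (0 : ℝ), deriv ζ x • v.fst x =
            ((∫ x in Ioi (0 : ℝ), deriv ζ x * η x : ℝ) : ℂ) := by
          rw [← integral_complex_ofReal]
          refine integral_congr_ae ?_
          filter_upwards [coeFn_testL2 h1.continuous h2] with x hx
          change deriv ζ x • testL2 h1.continuous h2 x = _
          rw [hx, Complex.real_smul, Complex.ofReal_mul]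
        have e2 : ∫ x in Ioi (0 : ℝ), ζ x • v.snd x =
            (m : ℂ)⁻¹ * ((∫ x in Ioi (0 : ℝ), ζ x * deriv η x : ℝ) : ℂ) := by
          rw [← integral_complex_ofReal, ← integral_const_mul]
          refine integral_congr_ae ?_
          have hs : ⇑(((m⁻¹ : ℝ) : ℂ) • testL2 hdc h2.deriv) =ᵐ[volume.restrict (Ioi (0 : ℝ))]
              ((m⁻¹ : ℝ) : ℂ) • ⇑(testL2 hdc h2.deriv) := Lp.coeFn_smul _ _
          filter_upwards [coeFn_testL2 hdc h2.deriv, hs] with x hx hx'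
          change ζ x • (((m⁻¹ : ℝ) : ℂ) • testL2 hdc h2.deriv) x = _
          rw [hx', Pi.smul_apply, hx, Complex.real_smul, smul_eq_mul]
          push_cast
          ring
        have hk : Continuous (deriv ζ) := k1.continuous_deriv (by simp)
        have e3 : ∫ x in Ioi (0 : ℝ), (deriv ζ x * η x + ζ x * deriv η x) = 0 := by
          have := (h2.mul_left (f := ζ)).integral_Ioi_deriv_eq ((k1.mul h1).of_le (by simp)) 0
          rw [hη0, mul_zero, neg_zero] at this
          refine Eq.trans ?_ this
          refine integral_congr_ae (Eventually.of_forall fun x => ?_)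
          exact (deriv_fun_mul (k1.differentiable (by simp) x) (h1.differentiable (by simp) x)).symm
        have i1 : IntegrableOn (fun x => deriv ζ x * η x) (Ioi 0) :=
          ((hk.mul h1.continuous).integrable_of_hasCompactSupport h2.mul_left).integrableOn
        have i2 : IntegrableOn (fun x => ζ x * deriv η x) (Ioi 0) :=
          ((k1.continuous.mul hdc).integrable_of_hasCompactSupport h2.deriv.mul_left).integrableOn
        rw [integral_add i1 i2] at e3
        rw [e1, e2, mul_inv_cancel_left₀ hm0, ← Complex.ofReal_add, e3, Complex.ofReal_zero]
      have hin : inner ℂ v w = inner ℂ v.fst h := by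
        have h4 := Submodule.inner_starProjection_left_eq_right (dirichletSpace m) v
          ((WithLp.fstL 2 ℂ L2Half L2Half).adjoint h)
        rw [Submodule.starProjection_eq_self_iff.mpr hvm,
          ContinuousLinearMap.adjoint_inner_right] at h4
        exact h4.symm
      rw [WithLp.prod_inner_apply] at hin
      have hin2 : inner ℂ (testL2 h1.continuous h2) w.fst +
          inner ℂ (((m⁻¹ : ℝ) : ℂ) • testL2 hdc h2.deriv) w.snd =
          inner ℂ (testL2 h1.continuous h2) h := hin
      rw [inner_smul_left, Complex.conj_ofReal, inner_testL2, inner_testL2, inner_testL2] at hin2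
      simp only [smul_sub]
      rw [integral_sub (integrable_smul_of_L2 (Lp.memLp _) h1.continuous h2)
        (integrable_smul_of_L2 (Lp.memLp _) h1.continuous h2)]
      simp only [smul_comm _ (m⁻¹ : ℝ), integral_smul]
      rw [Complex.real_smul]
      linear_combination hin2
    refine hgoal.congr hgc ?_
    filter_upwards [hfc] with x hx
    rw [hx, smul_smul, mul_inv_cancel₀ (by positivity), one_smul]

/-- The resolvent on the half-line with a prescribed boundary value. -/
lemma halfResolvent_spec {m : ℝ} (hm : 0 < m) (h : L2Half) (c : ℂ) {f : L2Half}
    (hf : f = dirichletResolvent m h + c • decay hm) :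
    ∃ g : L2Half, IsWeakDerivTrace f g c ∧ IsWeakDeriv (Ioi 0) g ((m ^ 2 : ℂ) • f - h : L2Half) ∧
      HasValueAtZero (Ioi 0) g (inner ℂ (decay hm) h - m * c) := by
  obtain ⟨g, h1, h2⟩ := dirichletResolvent_spec hm h
  set r := dirichletResolvent m h
  have hL : ∀ u : L2Half, MemLp u 2 (volume.restrict (Ioi (0 : ℝ))) := fun u => Lp.memLp u
  have hsm : ∀ (s : ℂ) (u : L2Half), ⇑(s • u) =ᵐ[volume.restrict (Ioi (0 : ℝ))] s • ⇑u :=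
    fun s u => Lp.coeFn_smul s u
  have hadd : ∀ u v : L2Half, ⇑(u + v) =ᵐ[volume.restrict (Ioi (0 : ℝ))] ⇑u + ⇑v :=
    fun u v => Lp.coeFn_add u v
  have hsub : ∀ u v : L2Half, ⇑(u - v) =ᵐ[volume.restrict (Ioi (0 : ℝ))] ⇑u - ⇑v :=
    fun u v => Lp.coeFn_sub u v
  have hdec : IsWeakDerivTrace (decay hm) (-(m : ℂ) • decay hm : L2Half) 1 := by
    refine (isWeakDerivTrace_exp_neg hm).congr (coeFn_decay hm) ?_
    filter_upwards [hsm (-(m : ℂ)) (decay hm), coeFn_decay hm] with x h3 h4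
    rw [h3, Pi.smul_apply, h4, smul_eq_mul]
  have hg1 : IsWeakDeriv (Ioi 0) g ((m ^ 2 : ℂ) • r - h : L2Half) := by
    refine h2.congr ae_eq_rfl ?_
    filter_upwards [hsm (m ^ 2 : ℂ) r, hsub ((m ^ 2 : ℂ) • r) h] with x h3 h4
    rw [h4, Pi.sub_apply, h3, Pi.smul_apply, smul_eq_mul, Complex.real_smul, Complex.ofReal_pow]
  have hr0 : HasValueAtZero (Ioi 0) r 0 := h1.hasValueAtZero (hL _) (hL _)
  have hg0 : HasValueAtZero (Ioi 0) g (inner ℂ (decay hm) h) := by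
    -- The growth equation for `g + m r`. Its boundary value is `⟨decay, h⟩`, and it equals that of
    -- `g` because `r` vanishes at the origin.
    have hd : IsWeakDeriv (Ioi 0) (g + (m : ℂ) • r : L2Half)
        fun x => m • (g + (m : ℂ) • r : L2Half) x - h x := by
      refine (IsWeakDeriv.add (hL _) ((hL r).const_smul (m : ℂ)) (hL _) ((hL _).const_smul (m : ℂ))
        hg1 (h1.isWeakDeriv.smul (m : ℂ))).congr ?_ ?_
      · filter_upwards [hadd g ((m : ℂ) • r), hsm (m : ℂ) r] with x h3 h4
        rw [h3, Pi.add_apply, h4, Pi.add_apply]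
      · filter_upwards [hadd g ((m : ℂ) • r), hsm (m : ℂ) r, hsm (m ^ 2 : ℂ) r,
          hsub ((m ^ 2 : ℂ) • r) h] with x h3 h4 h5 h6
        simp only [h3, Pi.add_apply, h4, h6, Pi.sub_apply, h5, Pi.smul_apply, smul_eq_mul,
          Complex.real_smul]
        ring
    have hv := hasValueAtZero_of_isWeakDeriv_growth hm (hL _) (hL _) hd
    rw [← inner_decay hm] at hv
    have hv2 := hv.add (hr0.smul (-(m : ℂ)))
    rw [smul_zero, add_zero] at hv2
    refine hv2.congr ?_
    filter_upwards [hadd g ((m : ℂ) • r), hsm (m : ℂ) r] with x h3 h4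
    rw [Pi.add_apply, h3, Pi.add_apply, h4, Pi.smul_apply, Pi.smul_apply]
    module
  refine ⟨g + c • (-(m : ℂ) • decay hm), ?_, ?_, ?_⟩
  · have := IsWeakDerivTrace.add (hL _) ((hL _).const_smul c) (hL _) ((hL _).const_smul c) h1
      (hdec.smul c)
    rw [zero_add, smul_eq_mul, mul_one] at this
    refine this.congr ?_ ?_
    · rw [hf]
      exact (hadd _ _).trans ((hsm _ _).add_left)
    · exact (hadd _ _).trans ((hsm _ _).add_left)
  · have := IsWeakDeriv.add (hL _) (((hL _).const_smul (-(m : ℂ))).const_smul c) (hL _)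
      (((hL _).const_smul (-(m : ℂ))).const_smul c) hg1 ((hdec.isWeakDeriv.smul (-(m : ℂ))).smul c)
    refine this.congr ?_ ?_
    · filter_upwards [hadd g (c • (-(m : ℂ) • decay hm)), hsm c (-(m : ℂ) • decay hm),
        hsm (-(m : ℂ)) (decay hm)] with x h3 h4 h5
      simp only [h3, Pi.add_apply, h4, Pi.smul_apply, h5]
    · have e : ((m ^ 2 : ℂ) • f - h) = ((m ^ 2 : ℂ) • r - h) +
          c • (-(m : ℂ) • (-(m : ℂ) • decay hm)) := by
        rw [hf]
        module
      rw [e]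
      filter_upwards [hadd ((m ^ 2 : ℂ) • r - h) (c • (-(m : ℂ) • (-(m : ℂ) • decay hm))),
        hsm c (-(m : ℂ) • (-(m : ℂ) • decay hm)), hsm (-(m : ℂ)) (-(m : ℂ) • decay hm)]
        with x h3 h4 h5
      simp only [h3, Pi.add_apply, h4, Pi.smul_apply, h5]
  · have hd0 : HasValueAtZero (Ioi 0) (decay hm) 1 := hdec.hasValueAtZero (hL _) (hL _)
    have := hg0.add ((hd0.smul (-(m : ℂ))).smul c)
    rw [smul_eq_mul, smul_eq_mul, mul_one, mul_neg, ← sub_eq_add_neg, mul_comm c] at this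
    refine this.congr ?_
    filter_upwards [hadd g (c • (-(m : ℂ) • decay hm)), hsm c (-(m : ℂ) • decay hm),
      hsm (-(m : ℂ)) (decay hm)] with x h3 h4 h5
    simp only [h3, Pi.add_apply, h4, Pi.smul_apply, h5]

/-! ### The resolvent on the star graph -/

lemma inner_dirichletResolvent (m : ℝ) (u v : L2Half) :
    inner ℂ (dirichletResolvent m u) v = inner ℂ u (dirichletResolvent m v) :=
  (ContinuousLinearMap.isSelfAdjoint_iff_isSymmetric.mp (isSelfAdjoint_dirichletResolvent m)) u v

/-- Such a `d` is `a exp (-m x)`. This gives uniqueness for both resolvent equations, edge by edge.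
-/
lemma L2_ode_solution {m : ℝ} (hm : 0 < m) {d g h : L2Half} (h1 : IsWeakDeriv (Ioi 0) d g)
    (h2 : IsWeakDeriv (Ioi 0) g h)
    (hh : h =ᵐ[volume.restrict (Ioi (0 : ℝ))] fun x => (m ^ 2 : ℂ) * d x) {a b : ℂ}
    (ha : HasValueAtZero (Ioi 0) d a) (hb : HasValueAtZero (Ioi 0) g b) :
    b = -m * a ∧ (a = 0 → d = 0) := by
  obtain ⟨c, hc1, hc2⟩ := ae_eq_exp_neg_of_isWeakDeriv hm (Lp.memLp d) (Lp.memLp g) h1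
    (h2.congr ae_eq_rfl (by
      filter_upwards [hh] with x hx
      rw [hx, Complex.real_smul, Complex.ofReal_pow]))
  have hac : c = a := ((hasValueAtZero_exp_neg m c).congr hc1).unique ha
  have hbc : -m * c = b := ((hasValueAtZero_exp_neg m (-m * c)).congr hc2).unique hb
  refine ⟨by rw [← hbc, hac], fun h0 => Lp.eq_zero_iff_ae_eq_zero.mpr ?_⟩
  filter_upwards [hc1] with x hx
  rw [hx, hac, h0, smul_zero, Pi.zero_apply]

/-- The common boundary value of the components of `graphResolvent`. -/
def graphTrace {m : ℝ} (hm : 0 < m) (γ : ℝ) : L2Graph →L[ℂ] ℂ :=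
  (3 * (m + γ) : ℂ)⁻¹ • ∑ k, innerSL ℂ (decay hm) ∘L PiLp.proj 2 (fun _ : Fin 3 => L2Half) k

/-- The resolvent `(m² - Δ_𝒢^γ)⁻¹`. -/
def graphResolvent {m : ℝ} (hm : 0 < m) (γ : ℝ) : L2Graph →L[ℂ] L2Graph :=
  ((PiLp.continuousLinearEquiv 2 ℂ fun _ : Fin 3 => L2Half).symm : _ →L[ℂ] L2Graph) ∘L
    ContinuousLinearMap.pi fun k =>
      dirichletResolvent m ∘L PiLp.proj 2 (fun _ : Fin 3 => L2Half) k +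
        (graphTrace hm γ).smulRight (decay hm)

lemma graphTrace_apply {m : ℝ} (hm : 0 < m) (γ : ℝ) (φ : L2Graph) :
    graphTrace hm γ φ = (3 * (m + γ) : ℂ)⁻¹ * ∑ k, inner ℂ (decay hm) (φ k) := by
  simp [graphTrace]

lemma graphResolvent_apply {m : ℝ} (hm : 0 < m) (γ : ℝ) (φ : L2Graph) (k : Fin 3) :
    graphResolvent hm γ φ k = dirichletResolvent m (φ k) + graphTrace hm γ φ • decay hm := rfl

lemma isSelfAdjoint_graphResolvent {m : ℝ} (hm : 0 < m) (γ : ℝ) :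
    IsSelfAdjoint (graphResolvent hm γ) := by
  rw [ContinuousLinearMap.isSelfAdjoint_iff_isSymmetric]
  intro φ ψ
  -- The correction to the Dirichlet part has rank one, with kernel `∑ j k, ⟨decay, φ j⟩ ⟨decay, ψ
  -- k⟩` up to conjugation and a real factor, so it is symmetric as well.
  change inner ℂ (graphResolvent hm γ φ) ψ = inner ℂ φ (graphResolvent hm γ ψ)
  simp only [PiLp.inner_apply, graphResolvent_apply, inner_add_left, inner_add_right,
    inner_smul_left, inner_smul_right, inner_dirichletResolvent, Finset.sum_add_distrib,
    ← Finset.mul_sum, graphTrace_apply, map_mul, map_inv₀, map_add, map_sum, inner_conj_symm,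
    Complex.conj_ofReal, map_ofNat]
  ring

lemma isGraphLaplacian_graphResolvent {m : ℝ} (hm : 0 < m) {γ : ℝ} (hγ : 0 < m + γ)
    (φ : L2Graph) :
    IsGraphLaplacian γ (graphResolvent hm γ φ)
      (((m ^ 2 : ℝ) : ℂ) • graphResolvent hm γ φ - φ) := by
  choose g h1 h2 h3 using fun k =>
    halfResolvent_spec hm (φ k) (graphTrace hm γ φ) (graphResolvent_apply hm γ φ k)
  refine ⟨WithLp.toLp 2 g, fun k => (h1 k).isWeakDeriv, fun k => ?_, graphTrace hm γ φ, _,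
    fun k => (h1 k).hasValueAtZero (Lp.memLp _) (Lp.memLp _), h3, ?_⟩
  · rw [Complex.ofReal_pow]
    exact h2 k
  -- The vertex condition reads `∑ k, (⟨decay, φ k⟩ - m a) = 3 γ a`; solving for `a` gives
  -- `graphTrace`, with its factor `(3 (m + γ))⁻¹`.
  · have h0 : (m + γ : ℂ) ≠ 0 := by exact_mod_cast hγ.ne'
    rw [Finset.sum_sub_distrib, Finset.sum_const, graphTrace_apply, Finset.card_univ,
      Fintype.card_fin, nsmul_eq_mul]
    field_simp
    push_cast
    ring

lemma eq_zero_of_isGraphLaplacian {m : ℝ} (hm : 0 < m) {γ : ℝ} (hγ : 0 < m + γ) {d : L2Graph}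
    (hd : IsGraphLaplacian γ d (((m ^ 2 : ℝ) : ℂ) • d)) : d = 0 := by
  obtain ⟨g, h1, h2, a, b, h3, h4, h5⟩ := hd
  have key := fun k => L2_ode_solution hm (h1 k) (h2 k) (by
    have h : ⇑(((m ^ 2 : ℝ) : ℂ) • d k) =ᵐ[volume.restrict (Ioi (0 : ℝ))]
        ((m ^ 2 : ℝ) : ℂ) • ⇑(d k) := Lp.coeFn_smul _ _
    filter_upwards [h] with x hx
    change (((m ^ 2 : ℝ) : ℂ) • d k) x = _
    rw [hx, Complex.ofReal_pow]
    rfl) (h3 k) (h4 k)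
  have h0 : (m + γ : ℂ) ≠ 0 := by exact_mod_cast hγ.ne'
  -- Every outgoing derivative is `-m a`, so the vertex condition becomes `-3 m a = 3 γ a`.
  have ha : a = 0 := by
    simp only [fun k => (key k).1, Finset.sum_const, Finset.card_univ, Fintype.card_fin,
      nsmul_eq_mul] at h5
    push_cast at h5
    have : (m + γ : ℂ) * a = 0 := by linear_combination (-1 / 3 : ℂ) * h5
    exact (mul_eq_zero.mp this).resolve_left h0
  ext1 k
  exact (key k).2 ha

/-! ### The two halves of a function on the line -/

/-- Reflection on `L²(ℝ)`. -/
def reflectLine : L2Line →L[ℂ] L2Line :=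
  (Lp.compMeasurePreservingₗᵢ ℂ (fun x : ℝ => -x)
    (Measure.measurePreserving_neg (volume : Measure ℝ))).toContinuousLinearMap

lemma coeFn_reflectLine (f : L2Line) : reflectLine f =ᵐ[volume] fun x => f (-x) :=
  Lp.coeFn_compMeasurePreserving f (Measure.measurePreserving_neg (volume : Measure ℝ))

/-- The function `x ↦ f (-x)` on `(0,∞)`. -/
def restrictNeg : L2Line →L[ℂ] L2Half := restrictHalf ∘L reflectLine

lemma coeFn_restrictNeg (f : L2Line) :
    restrictNeg f =ᵐ[volume.restrict (Ioi (0 : ℝ))] fun x => f (-x) :=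
  (coeFn_restrictHalf _).trans (ae_restrict_of_ae (coeFn_reflectLine f))

lemma measurePreserving_neg_Ioi : MeasurePreserving (fun x : ℝ => -x)
    (volume.restrict (Ioi 0)) (volume.restrict (Iio 0)) := by
  have h := (Measure.measurePreserving_neg (volume : Measure ℝ)).restrict_preimage
    (measurableSet_Iio (a := (0 : ℝ)))
  have e : (Neg.neg : ℝ → ℝ) ⁻¹' Iio 0 = Ioi 0 := by ext x; simp
  rw [e] at h
  exact h

lemma setIntegral_Ioi_comp_neg (F : ℝ → ℂ) :
    ∫ x in Ioi (0 : ℝ), F (-x) = ∫ x in Iio (0 : ℝ), F x :=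
  measurePreserving_neg_Ioi.integral_comp (Homeomorph.neg ℝ).measurableEmbedding F

lemma integral_eq_halves {F : ℝ → ℂ} (hF : Integrable F) :
    ∫ x, F x = (∫ x in Ioi (0 : ℝ), F x) + ∫ x in Ioi (0 : ℝ), F (-x) := by
  rw [setIntegral_Ioi_comp_neg, ← integral_add_compl measurableSet_Ioi hF, compl_Ioi,
    integral_Iic_eq_integral_Iio]

/-- Identifies `L²(ℝ)` with two copies of `L²(0,∞)`, so that the line is treated as a star with two
edges. -/
lemma inner_line (f g : L2Line) :
    inner ℂ f g = inner ℂ (restrictHalf f) (restrictHalf g) +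
      inner ℂ (restrictNeg f) (restrictNeg g) := by
  simp only [L2.inner_def]
  rw [integral_eq_halves (L2.integrable_inner f g)]
  congr 1
  · refine integral_congr_ae ?_
    filter_upwards [coeFn_restrictHalf f, coeFn_restrictHalf g] with x h1 h2
    rw [h1, h2]
  · refine integral_congr_ae ?_
    filter_upwards [coeFn_restrictNeg f, coeFn_restrictNeg g] with x h1 h2
    rw [h1, h2]

lemma line_ext {f g : L2Line} (h1 : restrictHalf f = restrictHalf g)
    (h2 : restrictNeg f = restrictNeg g) : f = g := by
  rw [← sub_eq_zero, ← inner_self_eq_zero (𝕜 := ℂ), inner_line, map_sub, map_sub, h1, h2]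
  simp

lemma restrictNeg_reflExtendL (σ : ℂ) (u : L2Half) : restrictNeg (reflExtendL σ u) = σ • u := by
  refine Lp.ext ?_
  have h := ae_comp_neg (coeFn_reflExtendL σ u)
  filter_upwards [coeFn_restrictNeg (reflExtendL σ u), ae_restrict_of_ae h, Lp.coeFn_smul σ u,
    ae_restrict_mem measurableSet_Ioi] with x h1 h2 h3 h4
  rw [h1, h2, h3]
  simp [reflExtend, mem_Ioi.mp h4]

/-- The function on the line with prescribed halves. -/
def joinHalves (u v : L2Half) : L2Line := reflExtendL 0 u + (reflExtendL 1 v - reflExtendL 0 v)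

/-- `reflExtendL 0` is extension by zero, and `reflExtendL 1 - reflExtendL 0` places the reflected
function on the negative half-line only. -/
lemma restrictHalf_joinHalves (u v : L2Half) : restrictHalf (joinHalves u v) = u := by
  simp [joinHalves, restrictHalf_reflExtendL]

lemma restrictNeg_joinHalves (u v : L2Half) : restrictNeg (joinHalves u v) = v := by
  simp [joinHalves, restrictNeg_reflExtendL]

/-! ### The resolvent on the line -/

/-- The value at the origin of `lineResolvent`. -/
def lineTrace {m : ℝ} (hm : 0 < m) (γ : ℝ) : L2Line →L[ℂ] ℂ :=
  (2 * (m + γ) : ℂ)⁻¹ • (innerSL ℂ (decay hm) ∘L (restrictHalf + restrictNeg))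

/-- The resolvent `(m² - Δ_ℝ^γ)⁻¹`. -/
def lineResolvent {m : ℝ} (hm : 0 < m) (γ : ℝ) : L2Line →L[ℂ] L2Line :=
  reflExtendL 0 ∘L (dirichletResolvent m ∘L restrictHalf + (lineTrace hm γ).smulRight (decay hm)) +
    (reflExtendL 1 - reflExtendL 0) ∘L
      (dirichletResolvent m ∘L restrictNeg + (lineTrace hm γ).smulRight (decay hm))

lemma lineTrace_apply {m : ℝ} (hm : 0 < m) (γ : ℝ) (f : L2Line) :
    lineTrace hm γ f = (2 * (m + γ) : ℂ)⁻¹ *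
      (inner ℂ (decay hm) (restrictHalf f) + inner ℂ (decay hm) (restrictNeg f)) := by
  simp [lineTrace, mul_add]

lemma lineResolvent_apply {m : ℝ} (hm : 0 < m) (γ : ℝ) (f : L2Line) :
    lineResolvent hm γ f =
      joinHalves (dirichletResolvent m (restrictHalf f) + lineTrace hm γ f • decay hm)
        (dirichletResolvent m (restrictNeg f) + lineTrace hm γ f • decay hm) := rfl

lemma isSelfAdjoint_lineResolvent {m : ℝ} (hm : 0 < m) (γ : ℝ) :
    IsSelfAdjoint (lineResolvent hm γ) := by
  rw [ContinuousLinearMap.isSelfAdjoint_iff_isSymmetric]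
  intro f g
  change inner ℂ (lineResolvent hm γ f) g = inner ℂ f (lineResolvent hm γ g)
  simp only [inner_line, lineResolvent_apply, restrictHalf_joinHalves, restrictNeg_joinHalves,
    inner_add_left, inner_add_right, inner_smul_left, inner_smul_right, inner_dirichletResolvent,
    lineTrace_apply, map_mul, map_inv₀, map_add, inner_conj_symm, Complex.conj_ofReal, map_ofNat]
  ring

/-- The odd/even decomposition intertwines the resolvents. -/
lemma oddEven_graphResolvent {m : ℝ} (hm : 0 < m) (γ : ℝ) (k : Fin 3) (φ : L2Graph) :
    oddEven k (graphResolvent hm γ φ) = lineResolvent hm γ (oddEven k φ) := by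
  have hp : ∀ ψ : L2Graph, restrictHalf (oddEven k ψ) = alpha k ψ :=
    fun ψ => restrictHalf_reflExtendL _ _
  have hn : ∀ ψ : L2Graph, restrictNeg (oddEven k ψ) = paritySign k • alpha k ψ :=
    fun ψ => restrictNeg_reflExtendL _ _
  -- For `α₁`, `α₂` the coefficients sum to zero, so the common trace cancels, as does the line
  -- trace of an odd function. For `α₃` both traces equal `(m + γ)⁻¹ ⟨decay, α₃ φ⟩`.
  have hα : alpha k (graphResolvent hm γ φ) = dirichletResolvent m (alpha k φ) +
      lineTrace hm γ (oddEven k φ) • decay hm := by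
    rw [lineTrace_apply, hp, hn]
    fin_cases k
    · simp [alpha, paritySign, graphResolvent_apply, -smul_add, -smul_neg, -neg_add_rev]
      module
    · simp [alpha, paritySign, graphResolvent_apply, -smul_add, -smul_neg]
      module
    · simp [alpha, paritySign, graphResolvent_apply, graphTrace_apply, Fin.sum_univ_three,
        inner_add_right, inner_smul_right]
      module
  -- Either the sign is `1` or the trace is zero.
  have hs : paritySign k • lineTrace hm γ (oddEven k φ) = lineTrace hm γ (oddEven k φ) := by
    rw [lineTrace_apply, hp, hn]
    fin_cases k <;> simp [paritySign]
  refine line_ext ?_ ?_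
  · rw [lineResolvent_apply, restrictHalf_joinHalves, hp, hp, hα]
  · rw [lineResolvent_apply, restrictNeg_joinHalves, hn, hn, hα, smul_add, map_smul, smul_smul,
      ← smul_eq_mul, hs]

/-! ### Gluing along the origin -/

lemma contDiff_comp_neg {η : ℝ → ℝ} (h : ContDiff ℝ ∞ η) : ContDiff ℝ ∞ fun x => η (-x) :=
  h.comp contDiff_neg

lemma hasCompactSupport_comp_neg {η : ℝ → ℝ} (h : HasCompactSupport η) :
    HasCompactSupport fun x => η (-x) :=
  h.comp_homeomorph (Homeomorph.neg ℝ)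

lemma tsupport_comp_neg {η : ℝ → ℝ} {x : ℝ} (hx : x ∈ tsupport fun x => η (-x)) :
    -x ∈ tsupport η := by
  have h : tsupport (fun x => η (-x)) ⊆ (fun x => -x) ⁻¹' tsupport η :=
    closure_minimal (fun y hy => subset_tsupport η hy) ((isClosed_tsupport η).preimage continuous_neg)
  exact h hx

lemma setIntegral_eq_of_tsupport_subset {Ω : Set ℝ} (hΩ : MeasurableSet Ω) {s : Set ℝ}
    (hs : s ⊆ Ω) {F : ℝ → ℂ} (hF : ∀ x, x ∉ s → F x = 0) : ∫ x in Ω, F x = ∫ x in s, F x :=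
  setIntegral_eq_of_subset_of_forall_sdiff_eq_zero hΩ hs fun x hx => hF x hx.2

lemma IsWeakDeriv.restrict_pos {Ω : Set ℝ} (hΩ : MeasurableSet Ω) (hs : Ioi 0 ⊆ Ω) {f g : ℝ → ℂ}
    (h : IsWeakDeriv Ω f g) : IsWeakDeriv (Ioi 0) f g := by
  intro η h1 h2 h3
  have e := h η h1 h2 (h3.trans hs)
  rwa [setIntegral_eq_of_tsupport_subset hΩ hs, setIntegral_eq_of_tsupport_subset hΩ hs] at e
  · exact fun x hx => by rw [image_eq_zero_of_notMem_tsupport fun h => hx (h3 h), zero_smul]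
  · exact fun x hx => by
      rw [image_eq_zero_of_notMem_tsupport fun h => hx (h3 (tsupport_deriv_subset h)), zero_smul]

lemma IsWeakDeriv.restrict_neg {Ω : Set ℝ} (hΩ : MeasurableSet Ω) (hs : Iio 0 ⊆ Ω) {f g : ℝ → ℂ}
    (h : IsWeakDeriv Ω f g) : IsWeakDeriv (Ioi 0) (fun x => f (-x)) fun x => -g (-x) := by
  intro η h1 h2 h3
  have hz : ∀ x, x ∉ Iio (0 : ℝ) → -x ∉ tsupport η := fun x hx hm =>
    hx (by simpa using h3 hm)
  have e := h (fun x => η (-x)) (contDiff_comp_neg h1) (hasCompactSupport_comp_neg h2)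
    fun x hx => hs (by simpa using h3 (tsupport_comp_neg hx))
  simp only [deriv_comp_neg] at e
  rw [setIntegral_eq_of_tsupport_subset hΩ hs, setIntegral_eq_of_tsupport_subset hΩ hs,
    ← setIntegral_Ioi_comp_neg, ← setIntegral_Ioi_comp_neg] at e
  · simp only [neg_neg, neg_smul, integral_neg] at e
    simp only [smul_neg, integral_neg]
    linear_combination -e
  · exact fun x hx => by rw [image_eq_zero_of_notMem_tsupport (hz x hx), zero_smul]
  · exact fun x hx => by
      rw [image_eq_zero_of_notMem_tsupport fun h => hz x hx (tsupport_deriv_subset h), neg_zero,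
        zero_smul]

/-- The boundary terms `η 0 • a` from the two sides cancel because both traces equal the same `a`.
-/
lemma isWeakDeriv_univ_of_halves {f g : ℝ → ℂ} {a : ℂ} (hf : MemLp f 2) (hg : MemLp g 2)
    (h1 : IsWeakDerivTrace f g a) (h2 : IsWeakDerivTrace (fun x => f (-x)) (fun x => -g (-x)) a) :
    IsWeakDeriv univ f g := by
  intro η k1 k2 _
  rw [Measure.restrict_univ]
  have hf' : MemLp f 2 (volume.restrict univ) := by rwa [Measure.restrict_univ]
  have hg' : MemLp g 2 (volume.restrict univ) := by rwa [Measure.restrict_univ]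
  have i1 := integrable_deriv_smul_of_L2 hf' k1 k2
  have i2 := integrable_smul_of_L2 hg' k1.continuous k2
  rw [Measure.restrict_univ] at i1 i2
  rw [integral_eq_halves i1, integral_eq_halves i2, h1 η k1 k2]
  have e := h2 _ (contDiff_comp_neg k1) (hasCompactSupport_comp_neg k2)
  simp only [deriv_comp_neg, neg_smul, smul_neg, integral_neg, neg_zero] at e
  linear_combination -e

/-- As `η` vanishes near `0`, cutting it off at `0` keeps it smooth. -/
lemma exists_testFunction_pos {η : ℝ → ℝ} (h1 : ContDiff ℝ ∞ η) (h2 : HasCompactSupport η)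
    (h3 : tsupport η ⊆ {0}ᶜ) :
    ∃ ζ : ℝ → ℝ, ContDiff ℝ ∞ ζ ∧ HasCompactSupport ζ ∧ tsupport ζ ⊆ Ioi 0 ∧
      EqOn ζ η (Ioi 0) := by
  have h0 : (0 : ℝ) ∉ tsupport η := fun h => h3 h rfl
  have hs : tsupport ((Ioi (0 : ℝ)).indicator η) ⊆ tsupport η ∩ Ici 0 := by
    refine closure_minimal (fun x hx => ?_) ((isClosed_tsupport η).inter isClosed_Ici)
    rw [support_indicator] at hx
    exact ⟨subset_tsupport η hx.2, (mem_Ioi.mp hx.1).le⟩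
  refine ⟨(Ioi (0 : ℝ)).indicator η, ?_, ?_, ?_, fun x hx => indicator_of_mem hx η⟩
  · rw [contDiff_iff_contDiffAt]
    intro x
    rcases lt_trichotomy x 0 with hx | rfl | hx
    · refine (contDiffAt_const (c := (0 : ℝ))).congr_of_eventuallyEq ?_
      filter_upwards [Iio_mem_nhds hx] with y hy
      exact indicator_of_notMem (fun h => lt_asymm h hy) η
    · refine (contDiffAt_const (c := (0 : ℝ))).congr_of_eventuallyEq ?_
      filter_upwards [(isClosed_tsupport η).isOpen_compl.mem_nhds h0] with y hy
      have : η y = 0 := image_eq_zero_of_notMem_tsupport hy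
      simp [indicator, this]
    · refine h1.contDiffAt.congr_of_eventuallyEq ?_
      filter_upwards [Ioi_mem_nhds hx] with y hy
      exact indicator_of_mem hy η
  · exact h2.isCompact.of_isClosed_subset (isClosed_tsupport _) (hs.trans inter_subset_left)
  · intro x hx
    have h4 := hs hx
    exact mem_Ioi.mpr ((mem_Ici.mp h4.2).lt_of_ne fun h => h0 (h ▸ h4.1))

lemma IsWeakDeriv.integral_pos {f g : ℝ → ℂ} (h : IsWeakDeriv (Ioi 0) f g) {η : ℝ → ℝ}
    (h1 : ContDiff ℝ ∞ η) (h2 : HasCompactSupport η) (h3 : tsupport η ⊆ {0}ᶜ) :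
    ∫ x in Ioi (0 : ℝ), deriv η x • f x = -∫ x in Ioi (0 : ℝ), η x • g x := by
  obtain ⟨ζ, k1, k2, k3, k4⟩ := exists_testFunction_pos h1 h2 h3
  have e1 : ∫ x in Ioi (0 : ℝ), deriv ζ x • f x = ∫ x in Ioi (0 : ℝ), deriv η x • f x :=
    setIntegral_congr_fun measurableSet_Ioi fun x hx => by
      simp only [(k4.eventuallyEq_of_mem (Ioi_mem_nhds hx)).deriv_eq]
  have e2 : ∫ x in Ioi (0 : ℝ), ζ x • g x = ∫ x in Ioi (0 : ℝ), η x • g x :=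
    setIntegral_congr_fun measurableSet_Ioi fun x hx => by simp only [k4 hx]
  rw [← e1, ← e2, h ζ k1 k2 k3]

lemma restrict_compl_zero : (volume : Measure ℝ).restrict {0}ᶜ = volume :=
  Measure.restrict_eq_self_of_ae_mem (by simp [ae_iff])

lemma isWeakDeriv_compl_zero_of_halves {f g : ℝ → ℂ} (hf : MemLp f 2) (hg : MemLp g 2)
    (h1 : IsWeakDeriv (Ioi 0) f g)
    (h2 : IsWeakDeriv (Ioi 0) (fun x => f (-x)) fun x => -g (-x)) :
    IsWeakDeriv {0}ᶜ f g := by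
  intro η k1 k2 k3
  have hf' : MemLp f 2 (volume.restrict {0}ᶜ) := by rwa [restrict_compl_zero]
  have hg' : MemLp g 2 (volume.restrict {0}ᶜ) := by rwa [restrict_compl_zero]
  have i1 := integrable_deriv_smul_of_L2 hf' k1 k2
  have i2 := integrable_smul_of_L2 hg' k1.continuous k2
  rw [restrict_compl_zero] at i1 i2 ⊢
  rw [integral_eq_halves i1, integral_eq_halves i2, h1.integral_pos k1 k2 k3]
  have e := h2.integral_pos (contDiff_comp_neg k1) (hasCompactSupport_comp_neg k2) fun x hx h => by
    rw [mem_singleton_iff] at h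
    exact k3 (tsupport_comp_neg hx) (by simp [h])
  simp only [deriv_comp_neg, neg_smul, smul_neg, integral_neg] at e
  linear_combination -e

lemma tendsto_neg_Ioi_Iio : Tendsto (fun x : ℝ => -x) (𝓝[>] 0) (𝓝[<] 0) := by
  simpa using tendsto_neg_nhdsGT (a := (0 : ℝ))

lemma tendsto_neg_Iio_Ioi : Tendsto (fun x : ℝ => -x) (𝓝[<] 0) (𝓝[>] 0) := by
  simpa using tendsto_neg_nhdsLT (a := (0 : ℝ))

lemma HasValueAtZero.comp_neg {f : ℝ → ℂ} {a : ℂ} (h : HasValueAtZero (Iio 0) f a) :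
    HasValueAtZero (Ioi 0) (fun x => f (-x)) a := by
  obtain ⟨F, h1, h2, h3⟩ := h
  exact ⟨fun x => F (-x), h1.comp continuousOn_neg fun x hx => by simpa using hx,
    measurePreserving_neg_Ioi.quasiMeasurePreserving.ae h2, h3.comp tendsto_neg_Ioi_Iio⟩

lemma HasValueAtZero.of_comp_neg {f : ℝ → ℂ} {a : ℂ}
    (h : HasValueAtZero (Ioi 0) (fun x => f (-x)) a) : HasValueAtZero (Iio 0) f a := by
  obtain ⟨F, h1, h2, h3⟩ := h
  refine ⟨fun x => F (-x), h1.comp continuousOn_neg fun x hx => by simpa using hx, ?_,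
    h3.comp tendsto_neg_Iio_Ioi⟩
  filter_upwards [measurePreserving_neg_Iio.quasiMeasurePreserving.ae h2] with x hx
  rw [← hx, neg_neg]

lemma HasValueAtZero.of_univ {f : ℝ → ℂ} {a : ℂ} (h : HasValueAtZero univ f a) (Ω : Set ℝ) :
    HasValueAtZero Ω f a := by
  obtain ⟨F, h1, h2, h3⟩ := h
  rw [Measure.restrict_univ] at h2
  exact ⟨F, h1.mono (subset_univ _), ae_restrict_of_ae h2,
    h3.mono_left (nhdsWithin_mono _ (subset_univ _))⟩

lemma hasValueAtZero_univ_of_halves {f : ℝ → ℂ} {a : ℂ} (h1 : HasValueAtZero (Ioi 0) f a)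
    (h2 : HasValueAtZero (Iio 0) f a) : HasValueAtZero univ f a := by
  obtain ⟨F, p1, p2, p3⟩ := h1
  obtain ⟨G, q1, q2, q3⟩ := h2
  set K : ℝ → ℂ := fun x => if 0 < x then F x else if x < 0 then G x else a with hK
  have hKp : ∀ x, 0 < x → K x = F x := fun x hx => by simp [hK, hx]
  have hKn : ∀ x, x < 0 → K x = G x := fun x hx => by simp [hK, hx, not_lt.mpr hx.le]
  have hK0 : K 0 = a := by simp [hK]
  have hc : Continuous K := by
    rw [continuous_iff_continuousAt]
    intro x
    rcases lt_trichotomy x 0 with hx | rfl | hx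
    · refine (q1.continuousAt (Iio_mem_nhds hx)).congr ?_
      filter_upwards [Iio_mem_nhds hx] with y hy
      exact (hKn y hy).symm
    · rw [continuousAt_iff_continuous_left'_right']
      constructor
      · rw [ContinuousWithinAt, hK0]
        refine q3.congr' ?_
        filter_upwards [self_mem_nhdsWithin] with y hy
        exact (hKn y hy).symm
      · rw [ContinuousWithinAt, hK0]
        refine p3.congr' ?_
        filter_upwards [self_mem_nhdsWithin] with y hy
        exact (hKp y hy).symm
    · refine (p1.continuousAt (Ioi_mem_nhds hx)).congr ?_
      filter_upwards [Ioi_mem_nhds hx] with y hy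
      exact (hKp y hy).symm
  refine ⟨K, hc.continuousOn, ?_, ?_⟩
  · rw [Measure.restrict_univ]
    refine ae_of_half ?_ ?_
    · filter_upwards [p2, ae_restrict_mem measurableSet_Ioi] with x hx hx'
      rw [hx, hKp x hx']
    · filter_upwards [q2, ae_restrict_mem measurableSet_Iio] with x hx hx'
      rw [hx, hKn x hx']
  · rw [nhdsWithin_univ, ← hK0]
    exact hc.tendsto 0

/-! ### The resolvent of the Laplacian on the line -/

lemma isLineLaplacian_lineResolvent {m : ℝ} (hm : 0 < m) {γ : ℝ} (hγ : 0 < m + γ) (φ : L2Line) :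
    IsLineLaplacian γ (lineResolvent hm γ φ)
      (((m ^ 2 : ℝ) : ℂ) • lineResolvent hm γ φ - φ) := by
  set f := lineResolvent hm γ φ with hf
  set c := lineTrace hm γ φ with hc
  have hfp : restrictHalf f = dirichletResolvent m (restrictHalf φ) + c • decay hm := by
    rw [hf, lineResolvent_apply, restrictHalf_joinHalves]
  have hfn : restrictNeg f = dirichletResolvent m (restrictNeg φ) + c • decay hm := by
    rw [hf, lineResolvent_apply, restrictNeg_joinHalves]
  obtain ⟨gp, p1, p2, p3⟩ := halfResolvent_spec hm (restrictHalf φ) c hfp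
  obtain ⟨gn, n1, n2, n3⟩ := halfResolvent_spec hm (restrictNeg φ) c hfn
  set h := ((m ^ 2 : ℝ) : ℂ) • f - φ with hh
  have hhp : restrictHalf h = (m ^ 2 : ℂ) • restrictHalf f - restrictHalf φ := by
    rw [hh, map_sub, map_smul, Complex.ofReal_pow]
  have hhn : restrictNeg h = (m ^ 2 : ℂ) • restrictNeg f - restrictNeg φ := by
    rw [hh, map_sub, map_smul, Complex.ofReal_pow]
  rw [← hhp] at p2
  rw [← hhn] at n2
  -- Reflection reverses the derivative, hence the sign on the negative half.
  set g := joinHalves gp (-gn) with hg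
  have hgp : ⇑g =ᵐ[volume.restrict (Ioi (0 : ℝ))] gp := by
    have := coeFn_restrictHalf g
    rw [hg, restrictHalf_joinHalves] at this
    exact this.symm
  have hgn : (fun x => -g (-x)) =ᵐ[volume.restrict (Ioi (0 : ℝ))] gn := by
    have := coeFn_restrictNeg g
    rw [hg, restrictNeg_joinHalves] at this
    filter_upwards [this, Lp.coeFn_neg gn] with x hx hx'
    rw [← hx, hx', Pi.neg_apply, neg_neg]
  have ep := (coeFn_restrictHalf f).symm
  have en := (coeFn_restrictNeg f).symm
  have hgn' : (fun x => g (-x)) =ᵐ[volume.restrict (Ioi (0 : ℝ))] (-1 : ℂ) • ⇑gn := by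
    filter_upwards [hgn] with x hx
    rw [Pi.smul_apply, ← hx]
    simp
  have hn : IsWeakDeriv (Ioi 0) (fun x => g (-x)) fun x => -h (-x) := by
    refine (n2.smul (-1)).congr hgn' ?_
    filter_upwards [coeFn_restrictNeg h] with x hx
    rw [Pi.smul_apply, hx]
    simp
  refine ⟨g, isWeakDeriv_univ_of_halves (Lp.memLp f) (Lp.memLp g) (p1.congr ep hgp)
    (n1.congr en hgn), isWeakDeriv_compl_zero_of_halves (Lp.memLp g) (Lp.memLp h)
    (p2.congr hgp (coeFn_restrictHalf h).symm) hn, c, _, _,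
    hasValueAtZero_univ_of_halves ((p1.hasValueAtZero (Lp.memLp _) (Lp.memLp _)).congr ep)
      (((n1.hasValueAtZero (Lp.memLp _) (Lp.memLp _)).congr en).of_comp_neg),
    p3.congr hgp, ((n3.smul (-1)).congr hgn').of_comp_neg, ?_⟩
  have h0 : (m + γ : ℂ) ≠ 0 := by exact_mod_cast hγ.ne'
  -- The jump is `⟨decay, φ₊⟩ + ⟨decay, φ₋⟩ - 2 m c`, where `φ₊` and `φ₋` are the two halves of `φ`;
  -- it equals `2 γ c` by the choice of `lineTrace`.
  rw [hc, lineTrace_apply, smul_eq_mul]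
  field_simp
  ring

lemma eq_zero_of_isLineLaplacian {m : ℝ} (hm : 0 < m) {γ : ℝ} (hγ : 0 < m + γ) {d : L2Line}
    (hd : IsLineLaplacian γ d (((m ^ 2 : ℝ) : ℂ) • d)) : d = 0 := by
  obtain ⟨g, h1, h2, a, b, c, h3, h4, h5, h6⟩ := hd
  have hmeas : MeasurableSet ({0}ᶜ : Set ℝ) := (measurableSet_singleton 0).compl
  have hneg : (fun x => -g (-x)) =ᵐ[volume.restrict (Ioi (0 : ℝ))] ⇑(-restrictNeg g) := by
    filter_upwards [coeFn_restrictNeg g, Lp.coeFn_neg (restrictNeg g)] with x hx hx'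
    rw [hx', Pi.neg_apply, hx]
  have hsm : ∀ᵐ x : ℝ, (((m ^ 2 : ℝ) : ℂ) • d) x = ((m ^ 2 : ℝ) : ℂ) * d x := Lp.coeFn_smul _ _
  have kp := L2_ode_solution hm
    ((h1.restrict_pos MeasurableSet.univ (subset_univ _)).congr (coeFn_restrictHalf d)
      (coeFn_restrictHalf g))
    ((h2.restrict_pos hmeas fun x hx => (mem_Ioi.mp hx).ne').congr (coeFn_restrictHalf g)
      (coeFn_restrictHalf _)) (by
      filter_upwards [coeFn_restrictHalf (((m ^ 2 : ℝ) : ℂ) • d), coeFn_restrictHalf d,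
        ae_restrict_of_ae hsm] with x e1 e2 e3
      rw [e1, e3, e2, Complex.ofReal_pow])
    ((h3.of_univ (Ioi 0)).congr (coeFn_restrictHalf d)) (h4.congr (coeFn_restrictHalf g))
  have kn := L2_ode_solution hm
    ((h1.restrict_neg MeasurableSet.univ (subset_univ _)).congr (coeFn_restrictNeg d) hneg.symm)
    (h := restrictNeg (((m ^ 2 : ℝ) : ℂ) • d)) (b := -c) (a := a) (by
      have := (h2.restrict_neg hmeas fun x hx => (mem_Iio.mp hx).ne).smul (-1)
      refine this.congr ?_ ?_
      · filter_upwards [hneg] with x hx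
        rw [← hx]
        simp
      · filter_upwards [coeFn_restrictNeg (((m ^ 2 : ℝ) : ℂ) • d)] with x hx
        rw [hx]
        simp) (by
      filter_upwards [coeFn_restrictNeg (((m ^ 2 : ℝ) : ℂ) • d), coeFn_restrictNeg d,
        ae_restrict_of_ae (ae_comp_neg hsm)] with x e1 e2 e3
      rw [e1, e3, e2, Complex.ofReal_pow])
    ((h3.of_univ (Iio 0)).comp_neg.congr (coeFn_restrictNeg d)) (by
      have := h5.comp_neg.smul (-1)
      rw [smul_eq_mul, neg_one_mul] at this
      refine this.congr ?_
      filter_upwards [hneg] with x hx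
      rw [← hx]
      simp)
  have h0 : (m + γ : ℂ) ≠ 0 := by exact_mod_cast hγ.ne'
  -- The one-sided derivatives are `b = -m a` and `c = m a`, so the jump condition becomes `-2 m a =
  -- 2 γ a`.
  have ha : a = 0 := by
    have : (m + γ : ℂ) * a = 0 := by
      linear_combination (-1 / 2 : ℂ) * h6 + (1 / 2 : ℂ) * kp.1 + (1 / 2 : ℂ) * kn.1
    exact (mul_eq_zero.mp this).resolve_left h0
  refine line_ext ?_ ?_
  · rw [kp.2 ha, map_zero]
  · rw [kn.2 ha, map_zero]

end StarGraph

end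

/-! ### The main theorem. -/

theorem proposition4p2 (γ : ℝ) :
    -- the propagators exist and are uniquely determined by their generators
    (∃! U : ℝ → L2Graph →L[ℂ] L2Graph, IsUnitaryGroupOf (graphLaplacian γ) U) ∧
    (∃! V : ℝ → L2Line →L[ℂ] L2Line, IsUnitaryGroupOf (lineLaplacian γ) V) ∧
    -- the intertwining relation
    (∀ (k : Fin 3) (t : ℝ) (φ : L2Graph),
      oddEven k (propagator (graphLaplacian γ) t φ) =
        propagator (lineLaplacian γ) t (oddEven k φ)) ∧
    -- the propagator on the line acts on the parity triples, and conjugation by `𝒬`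
    ∃ h𝒦 : ∀ (t : ℝ), ∀ f ∈ parityTriples,
        (fun k => propagator (lineLaplacian γ) t (f k)) ∈ parityTriples,
      ∀ (t : ℝ) (φ : L2Graph),
        propagator (graphLaplacian γ) t φ =
          oddEvenEquiv.symm ⟨fun k => propagator (lineLaplacian γ) t ((oddEvenEquiv φ).1 k),
            h𝒦 t _ (oddEvenEquiv φ).2⟩ := by
  -- The choice `m = |γ| + 1` gives `m + γ ≥ 1` for either sign of `γ`, and serves both operators,
  -- so that their resolvents are compared at the same point.
  have hm : 0 < |γ| + 1 := by positivity
  have hγ : 0 < |γ| + 1 + γ := by linarith [neg_abs_le γ]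
  have hG1 : ∀ φ, (graphResolvent hm γ φ, (((|γ| + 1) ^ 2 : ℝ) : ℂ) • graphResolvent hm γ φ - φ) ∈
      (graphLaplacian γ).graph := fun φ =>
    (mem_graph_graphLaplacian γ _ _).mpr (isGraphLaplacian_graphResolvent hm hγ φ)
  have hG2 : ∀ d, (d, (((|γ| + 1) ^ 2 : ℝ) : ℂ) • d) ∈ (graphLaplacian γ).graph → d = 0 :=
    fun d hd => eq_zero_of_isGraphLaplacian hm hγ ((mem_graph_graphLaplacian γ _ _).mp hd)
  have hL1 : ∀ φ, (lineResolvent hm γ φ, (((|γ| + 1) ^ 2 : ℝ) : ℂ) • lineResolvent hm γ φ - φ) ∈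
      (lineLaplacian γ).graph := fun φ =>
    (mem_graph_lineLaplacian γ _ _).mpr (isLineLaplacian_lineResolvent hm hγ φ)
  have hL2 : ∀ d, (d, (((|γ| + 1) ^ 2 : ℝ) : ℂ) • d) ∈ (lineLaplacian γ).graph → d = 0 :=
    fun d hd => eq_zero_of_isLineLaplacian hm hγ ((mem_graph_lineLaplacian γ _ _).mp hd)
  obtain ⟨hGd, hGe⟩ := exists_unitaryGroup_of_resolvent (isSelfAdjoint_graphResolvent hm γ) hG1 hG2
  obtain ⟨hLd, hLe⟩ := exists_unitaryGroup_of_resolvent (isSelfAdjoint_lineResolvent hm γ) hL1 hL2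
  have hU := isUnitaryGroupOf_propagator hGe
  have hV := isUnitaryGroupOf_propagator hLe
  have hint : ∀ (k : Fin 3) (t : ℝ) (φ : L2Graph),
      oddEven k (propagator (graphLaplacian γ) t φ) =
        propagator (lineLaplacian γ) t (oddEven k φ) := by
    intro k t φ
    refine hU.intertwine hV hGd (oddEven k) (fun f h hfh => ?_) t φ
    -- Membership in either graph is an equation for its resolvent, so intertwining the resolvents
    -- carries one graph into the other.
    rw [graph_iff_of_resolvent hG1 hG2] at hfh
    rw [graph_iff_of_resolvent hL1 hL2, ← map_smul, ← map_sub, ← oddEven_graphResolvent, hfh]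
  have hK : ∀ (t : ℝ), ∀ f ∈ parityTriples,
      (fun k => propagator (lineLaplacian γ) t (f k)) ∈ parityTriples := by
    intro t f hf
    -- Every parity triple is some `𝒬 φ`, and by the intertwining its evolution is `𝒬` of the
    -- evolved `φ`.
    obtain ⟨φ, hφ⟩ := oddEvenEquiv.surjective ⟨f, hf⟩
    have e : f = fun k => oddEven k φ := congrArg Subtype.val hφ.symm
    rw [e]
    simp only [← hint]
    exact oddEven_mem _
  refine ⟨⟨_, hU, fun U hU' => hU'.unique hU hGd⟩, ⟨_, hV, fun V hV' => hV'.unique hV hLd⟩, hint,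
    hK, fun t φ => ?_⟩
  rw [LinearEquiv.eq_symm_apply]
  ext1
  funext k
  exact hint k t φ
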